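/- Let $q=p^e>2$ be a prime power ($p$ prime), $r\ge 1$ a divisor of $2e$, $\psi:x\mapsto x^p$ the Frobenius map of $\mathbb F_{q^2}$, and let $\lambda\in\mathbb F_{q^2}^{*}$ be such that $\lambda^q$ belongs to the $\langle\psi^r\rangle$-orbit of $\lambda$. Let $\beta(\mathbf u_1,\mathbf u_2)=-x_1x_2^q+y_1z_2^q+z_1y_2^q$ on $\mathbb F_{q^2}^3$. The Hermitian unital $U_H(q)$ has as points the 1-dimensional subspaces $\langle\mathbf u\rangle$ with $\mathbf u\neq 0$ and $\beta(\mathbf u,\mathbf u)=0$, and as lines the sets of all such points contained in $\langle\mathbf u_1,\mathbf u_2\rangle$, for linearly independent isotropic vectors $\mathbf u_1,\mathbf u_2$. Let $V(q)$ be its set of flags (incident point-line pairs). The unitary graph $\Gamma=\Gamma_{r,\lambda}(q)$ has vertex set $V(q)$, and two flags $(\sigma_1,L_1)$, $(\sigma_2,L_2)$ are adjacent if and only if there are vectors $\mathbf u_0,\mathbf u_1,\mathbf u_2$ and an integer $0\le i<2e/r$ such that $\sigma_1=\langle\mathbf u_1\rangle$, $\sigma_2=\langle\mathbf u_2\rangle$,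 $\beta(\mathbf u_1,\mathbf u_2)=1$, $\beta(\mathbf u_0,\mathbf u_0)=-1$, $\beta(\mathbf u_0,\mathbf u_1)=\beta(\mathbf u_0,\mathbf u_2)=0$, and $L_1$, $L_2$ consist of the points $\langle x,y,z\rangle$ of $U_H(q)$ satisfying, with $\mathbf x=(x,y,z)$, $$L_1:\ \det(\mathbf x,\ \mathbf u_1,\ \mathbf u_0+\mathbf u_2)=0,\qquad L_2:\ \det(\mathbf x,\ \mathbf u_2,\ \mathbf u_0+\lambda^{qp^{ir}}\mathbf u_1)=0 .$$ Let $\mathcal C=\{C(L): L \text{ a line of } U_H(q)\}$, where $C(L)$ is the set of flags with line-entry $L$; this is a partition of $V(q)$ into independent sets of size $q+1$. Let $\Gamma_{\mathcal C}$ be the quotient graph (vertex set $\mathcal C$, two blocks adjacent if and only if $\Gamma$ has an edge between them). For $x\in\mathbb F_{q^2}$ let $\langle\psi^r\rangle_x$ be the stabilizer of $x$ in $\langle\psi^r\rangle$. Put $k^*=|\langle\psi^r\rangle|/|\langle\psi^r\rangle_\lambda|$ and, if $\lambda\ne1$, $l^*=|\langle\psi^r\rangle|/|\langle\psi^r\rangle_\eta|$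 with $\eta=\left(\frac{1-\lambda}{\lambda}\right)^{q+1}$; in this case $l^*$ divides $k^*$. For $B\in\mathcal C$ let $\Gamma(B)$ be the union of the neighbourhoods in $\Gamma$ of the vertices in $B$. $\Gamma$ is called a multicover (an almost multicover) of $\Gamma_{\mathcal C}$ if $|\Gamma(C)\cap B|=|B|$ (respectively $|B|-1$) for all adjacent blocks $B,C$ of $\Gamma_{\mathcal C}$. Then: (a) the valency of $\Gamma_{\mathcal C}$ is $q(q-1)$ if $\lambda=1$; $q(q^2-1)l^*$ if $\lambda\ne1$ and $\lambda+\lambda^q\ne1$; and $(q+1)(q^2-1)$ if $\lambda+\lambda^q=1$; (b) the number of blocks of $\mathcal C$ containing at least one neighbour of a fixed vertex of $\Gamma$ is $q(q-1)$ if $\lambda=1$; $q(q^2-1)l^*$ if $\lambda\ne1$ and $\lambda+\lambda^q\ne1$; and $q(q^2-1)$ if $\lambda+\lambda^q=1$; (c) if $\lambda=1$, then $\Gamma$ is isomorphic to the lexicographic product of $\Gamma_{\mathcal C}$ with the empty graph on $q+1$ vertices; if $\lambda\ne1$ and $\lambda+\lambda^q\ne1$, then $\Gamma$ is a multicover of $\Gamma_{\mathcal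 C}$, and for adjacent blocks $C(L_1),C(L_2)$ the bipartite subgraph of $\Gamma$ induced on $C(L_1)\cup C(L_2)$ is regular of valency $k^*/l^*$; if $\lambda+\lambda^q=1$, then $\Gamma$ is an almost multicover of $\Gamma_{\mathcal C}$, and for adjacent blocks this bipartite subgraph has exactly two isolated vertices and all its other vertices have valency $k^*$. -/

import Mathlib

/-! ### Quotients of graphs by partitions, multicovers, lexicographic products -/

/-- The quotient graph of `Γ` relative to a partition `P` of its vertex set: two distinct blocks
are adjacent if and only if there is at least one edge of `Γ` between them. -/
def quotientGraph {V : Type*} (Γ : SimpleGraph V) (P : Set (Set V)) : SimpleGraph P where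
  Adj B C := B ≠ C ∧ ∃ v ∈ (B : Set V), ∃ w ∈ (C : Set V), Γ.Adj v w
  symm := ⟨fun _ _ ⟨hne, v, hv, w, hw, h⟩ => ⟨hne.symm, w, hw, v, hv, h.symm⟩⟩
  loopless := ⟨fun _ h => h.1 rfl⟩

/-- Every vertex of `Γ` has exactly `n` neighbours. -/
def HasValency {V : Type*} (Γ : SimpleGraph V) (n : ℕ) : Prop :=
  ∀ v, (Γ.neighborSet v).ncard = n

/-- The neighbourhood of a set of vertices: the union of the neighbourhoods of its members. -/
def setNeighbors {V : Type*} (Γ : SimpleGraph V) (B : Set V) : Set V :=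
  ⋃ v ∈ B, Γ.neighborSet v

/-- `Γ` is a multicover of its quotient relative to `P`: `|Γ(C) ∩ B| = |B|` for all adjacent
blocks `B`, `C`. -/
def IsMulticover {V : Type*} (Γ : SimpleGraph V) (P : Set (Set V)) : Prop :=
  ∀ B C : P, (quotientGraph Γ P).Adj B C →
    (setNeighbors Γ C ∩ B).ncard = (B : Set V).ncard

/-- `Γ` is an almost multicover of its quotient relative to `P`: `|Γ(C) ∩ B| = |B| - 1` for all
adjacent blocks `B`, `C`. -/
def IsAlmostMulticover {V : Type*} (Γ : SimpleGraph V) (P : Set (Set V)) : Prop :=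
  ∀ B C : P, (quotientGraph Γ P).Adj B C →
    (setNeighbors Γ C ∩ B).ncard + 1 = (B : Set V).ncard

/-- The lexicographic product of `G` with `H`. -/
def lexProduct {V W : Type*} (G : SimpleGraph V) (H : SimpleGraph W) : SimpleGraph (V × W) where
  Adj a b := G.Adj a.1 b.1 ∨ (a.1 = b.1 ∧ H.Adj a.2 b.2)
  symm := ⟨fun _ _ h => h.elim (fun h => Or.inl h.symm) (fun h => Or.inr ⟨h.1.symm, h.2.symm⟩)⟩
  loopless := ⟨fun a h => h.elim (fun h => G.loopless.irrefl a.1 h)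
    (fun h => H.loopless.irrefl a.2 h.2)⟩

/-! ### The Hermitian unital -/

/-- The Hermitian form `-x₁ x₂^q + y₁ z₂^q + z₁ y₂^q` on the three-dimensional space `K³`, where
`K` is a field of order `q²`. -/
def hermForm {K : Type*} [Field K] (q : ℕ) (u v : Fin 3 → K) : K :=
  -(u 0 * v 0 ^ q) + u 1 * v 2 ^ q + u 2 * v 1 ^ q

/-- The absolute points: one-dimensional subspaces spanned by isotropic vectors. -/
def absolutePoints (K : Type*) [Field K] (q : ℕ) : Set (Submodule K (Fin 3 → K)) :=
  {P | ∃ u : Fin 3 → K, u ≠ 0 ∧ hermForm q u u = 0 ∧ P = Submodule.span K {u}}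

/-- The lines of the Hermitian unital: for linearly independent isotropic `u₁`, `u₂`, the set of
all absolute points contained in the subspace spanned by `u₁` and `u₂`. -/
def unitalLines (K : Type*) [Field K] (q : ℕ) : Set (Set (Submodule K (Fin 3 → K))) :=
  {L | ∃ u₁ u₂ : Fin 3 → K, LinearIndependent K ![u₁, u₂] ∧
    hermForm q u₁ u₁ = 0 ∧ hermForm q u₂ u₂ = 0 ∧
    L = {P | P ∈ absolutePoints K q ∧ P ≤ Submodule.span K {u₁, u₂}}}

/-- The flags of the Hermitian unital: incident point-line pairs. -/
def unitalFlags (K : Type*) [Field K] (q : ℕ) :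
    Set (Submodule K (Fin 3 → K) × Set (Submodule K (Fin 3 → K))) :=
  {f | f.1 ∈ absolutePoints K q ∧ f.2 ∈ unitalLines K q ∧ f.1 ∈ f.2}

/-- The set of flags with line-entry `L`. -/
def flagsOnLine {K : Type*} [Field K] (q : ℕ) (L : Set (Submodule K (Fin 3 → K))) :
    Set (unitalFlags K q) :=
  {f | f.1.2 = L}

/-- The partition of the flags of the Hermitian unital by their line-entries. -/
def linePartition (K : Type*) [Field K] (q : ℕ) : Set (Set (unitalFlags K q)) :=
  {C | ∃ L ∈ unitalLines K q, C = flagsOnLine q L}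

/-! ### The Frobenius map and orbit lengths -/

/-- The Frobenius automorphism `x ↦ x ^ p` of a finite field of characteristic `p`. -/
noncomputable def frob (p : ℕ) (K : Type*) [Fact p.Prime] [Field K] [Finite K] [CharP K p] :
    RingAut K :=
  frobeniusEquiv K p

/-- The group generated by `x ↦ x ^ (p ^ r)`. -/
noncomputable def frobGroup (p r : ℕ) (K : Type*) [Fact p.Prime] [Field K] [Finite K]
    [CharP K p] : Subgroup (RingAut K) :=
  Subgroup.zpowers (frob p K ^ r)

/-- The order of the group `frobGroup p r K` divided by the order of the stabilizer of `x`. -/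
noncomputable def kNumber (p r : ℕ) {K : Type*} [Fact p.Prime] [Field K] [Finite K]
    [CharP K p] (x : K) : ℕ :=
  Nat.card (frobGroup p r K) / Nat.card (MulAction.stabilizer (frobGroup p r K) x)

/-- The number `kNumber` of the element `((1 - x) / x) ^ (q + 1)`. -/
noncomputable def lNumber (p e r : ℕ) {K : Type*} [Fact p.Prime] [Field K] [Finite K]
    [CharP K p] (x : K) : ℕ :=
  kNumber p r (((1 - x) / x) ^ (p ^ e + 1))

/-! ### The unitary graphs -/

/-- The set of absolute points `⟨x, y, z⟩` on the projective line with equation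
`det [(x, y, z), v, w] = 0`. -/
def detLine {K : Type*} [Field K] (q : ℕ) (v w : Fin 3 → K) : Set (Submodule K (Fin 3 → K)) :=
  {P | P ∈ absolutePoints K q ∧ ∀ x ∈ P,
    Matrix.det !![x 0, v 0, w 0; x 1, v 1, w 1; x 2, v 2, w 2] = 0}

/-- The adjacency relation of the unitary graph with parameters `r`, `lam` over a field of order
`q²`, `q = p ^ e`. The vectors `u₁`, `u₂` representing the two points are normalized by
`β(u₁, u₂) = 1`, and the nonisotropic vector `u₀` orthogonal to both by `β(u₀, u₀) = -1`. -/
def unitaryAdj (p e r : ℕ) {K : Type*} [Field K] (lam : K)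
    (f g : unitalFlags K (p ^ e)) : Prop :=
  ∃ u₀ u₁ u₂ : Fin 3 → K, ∃ i : ℕ, i < 2 * e / r ∧
    f.1.1 = Submodule.span K {u₁} ∧ g.1.1 = Submodule.span K {u₂} ∧
    hermForm (p ^ e) u₁ u₂ = 1 ∧ hermForm (p ^ e) u₀ u₀ = -1 ∧
    hermForm (p ^ e) u₀ u₁ = 0 ∧ hermForm (p ^ e) u₀ u₂ = 0 ∧
    f.1.2 = detLine (p ^ e) u₁ (u₀ + u₂) ∧
    g.1.2 = detLine (p ^ e) u₂ (u₀ + lam ^ (p ^ e * p ^ (i * r)) • u₁)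

theorem detLine_smul {K : Type*} [Field K] (q : ℕ) (v w : Fin 3 → K) {c : K} (hc : c ≠ 0) :
    detLine q (c • v) w = detLine q v w := by
  have key : ∀ x : Fin 3 → K,
      Matrix.det !![x 0, (c • v) 0, w 0; x 1, (c • v) 1, w 1; x 2, (c • v) 2, w 2] =
        c * Matrix.det !![x 0, v 0, w 0; x 1, v 1, w 1; x 2, v 2, w 2] := by
    intro x
    simp only [Matrix.det_fin_three, Pi.smul_apply, smul_eq_mul, Matrix.of_apply,
      Matrix.cons_val', Matrix.cons_val_zero, Matrix.cons_val_one, Matrix.cons_val]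
    ring
  unfold detLine
  ext P
  simp only [Set.mem_ofPred_eq, key, mul_eq_zero, hc, false_or]

theorem frob_pow_apply (p : ℕ) {K : Type*} [Fact p.Prime] [Field K] [Finite K] [CharP K p]
    (n : ℕ) (x : K) : (frob p K ^ n) x = x ^ p ^ n := by
  induction n generalizing x with
  | zero => simp
  | succ n ih =>
    rw [pow_succ, RingAut.mul_apply, ih, pow_succ', pow_mul]
    rfl

theorem exists_pow_eq (p e r : ℕ) {K : Type*} [Fact p.Prime] [Field K] [Finite K] [CharP K p]
    (hq : 2 < p ^ e) (hK : Nat.card K = (p ^ e) ^ 2) (hr : r ∣ 2 * e) {lam : K}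
    (hlam : lam ^ p ^ e ∈ MulAction.orbit (frobGroup p r K) lam) (i : ℕ) :
    ∃ j < 2 * e / r, lam ^ p ^ (i * r) = lam ^ (p ^ e * p ^ (j * r)) := by
  have he : 0 < e := by
    rcases Nat.eq_zero_or_pos e with h | h
    · subst h; simp at hq
    · exact h
  have hcard : ∀ x : K, x ^ (p ^ (2 * e)) = x := by
    intro x
    have := Fintype.ofFinite K
    have h := FiniteField.pow_card x
    rw [← Nat.card_eq_fintype_card, hK, ← pow_mul] at h
    rwa [mul_comm 2 e]
  have hmult : ∀ (m : ℕ) (x : K), x ^ (p ^ (2 * e * m)) = x := by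
    intro m
    induction m with
    | zero => intro x; simp
    | succ m ih => intro x; rw [mul_add, mul_one, pow_add, pow_mul, ih, hcard]
  obtain ⟨n, hn⟩ := hr
  have hr0 : 0 < r := by
    rcases Nat.eq_zero_or_pos r with h | h
    · subst h; omega
    · exact h
  have hn0 : 0 < n := by
    rcases Nat.eq_zero_or_pos n with h | h
    · subst h; omega
    · exact h
  have hdiv : 2 * e / r = n := by rw [hn]; exact Nat.mul_div_cancel_left n hr0
  obtain ⟨⟨g, hg⟩, hgl⟩ := hlam
  have : Finite (RingAut K) := Finite.of_injective (fun f : RingAut K => (f : K → K))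
    DFunLike.coe_injective
  obtain ⟨t, rfl⟩ := (mem_powers_iff_mem_zpowers (x := frob p K ^ r)).2 hg
  have ht : lam ^ p ^ (r * t) = lam ^ p ^ e := by
    have h : ((frob p K ^ r) ^ t) lam = lam ^ p ^ e := hgl
    rwa [← pow_mul, frob_pow_apply] at h
  have h1 : lam = lam ^ (p ^ e * p ^ (r * t)) := by
    have h2 := hcard lam
    rw [two_mul, pow_add, pow_mul, ← ht, ← pow_mul, mul_comm] at h2
    exact h2.symm
  refine ⟨(i + t) % n, by rw [hdiv]; exact Nat.mod_lt _ hn0, ?_⟩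
  have h3 : lam ^ p ^ (i * r) = lam ^ (p ^ e * p ^ ((i + t) * r)) := by
    conv_lhs => rw [h1]
    rw [← pow_mul]
    congr 1
    rw [mul_assoc, ← pow_add]
    congr 2
    ring
  rw [h3]
  have h4 : (i + t) * r = 2 * e * ((i + t) / n) + (i + t) % n * r := by
    rw [hn]
    conv_lhs => rw [← Nat.div_add_mod (i + t) n]
    ring
  rw [h4, pow_add, mul_left_comm, pow_mul, hmult]

theorem hermForm_swap (p e : ℕ) {K : Type*} [Fact p.Prime] [Field K] [Finite K] [CharP K p]
    (hK : Nat.card K = (p ^ e) ^ 2) (u v : Fin 3 → K) :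
    hermForm (p ^ e) v u = hermForm (p ^ e) u v ^ p ^ e := by
  have hcard : ∀ x : K, (x ^ p ^ e) ^ p ^ e = x := by
    intro x
    have := Fintype.ofFinite K
    have h := FiniteField.pow_card x
    rw [← Nat.card_eq_fintype_card, hK, pow_two, pow_mul] at h
    exact h
  have hadd : ∀ x y : K, (x + y) ^ p ^ e = x ^ p ^ e + y ^ p ^ e :=
    fun x y => add_pow_char_pow x y p e
  have hneg : ∀ x : K, (-x) ^ p ^ e = -(x ^ p ^ e) := by
    intro x
    have h := hadd (-x) x
    rw [neg_add_cancel, zero_pow (pow_ne_zero _ (Fact.out : p.Prime).ne_zero)] at h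
    exact eq_neg_of_add_eq_zero_left h.symm
  simp only [hermForm, hadd, hneg, mul_pow, hcard]
  ring

theorem hermForm_smul_smul {K : Type*} [Field K] (q : ℕ) (a b : K) (u v : Fin 3 → K) :
    hermForm q (a • u) (b • v) = a * b ^ q * hermForm q u v := by
  simp only [hermForm, Pi.smul_apply, smul_eq_mul, mul_pow]
  ring

theorem unitaryAdj_symm (p e r : ℕ) {K : Type*} [Fact p.Prime] [Field K] [Finite K] [CharP K p]
    (hq : 2 < p ^ e) (hK : Nat.card K = (p ^ e) ^ 2) (hr : r ∣ 2 * e) {lam : K} (h0 : lam ≠ 0)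
    (hlam : lam ^ p ^ e ∈ MulAction.orbit (frobGroup p r K) lam)
    {f g : unitalFlags K (p ^ e)} (h : unitaryAdj p e r lam f g) : unitaryAdj p e r lam g f := by
  obtain ⟨u₀, u₁, u₂, i, -, hf, hg, h12, h00, h01, h02, hL, hN⟩ := h
  obtain ⟨j, hj, hij⟩ := exists_pow_eq p e r hq hK hr hlam i
  set s : K := lam ^ (p ^ e * p ^ (i * r)) with hs
  have hs0 : s ≠ 0 := pow_ne_zero _ h0
  have hsq : s ^ p ^ e ≠ 0 := pow_ne_zero _ hs0
  have hcard : ∀ x : K, (x ^ p ^ e) ^ p ^ e = x := by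
    intro x
    have := Fintype.ofFinite K
    have h := FiniteField.pow_card x
    rw [← Nat.card_eq_fintype_card, hK, pow_two, pow_mul] at h
    exact h
  have hsj : lam ^ (p ^ e * p ^ (j * r)) = s ^ p ^ e := by
    rw [← hij, hs, ← pow_mul, mul_right_comm, pow_mul lam (p ^ e * p ^ e), pow_mul lam (p ^ e), hcard]
  have h21 : hermForm (p ^ e) u₂ u₁ = 1 := by rw [hermForm_swap p e hK, h12, one_pow]
  have one_s : ∀ u : Fin 3 → K, u = (1 : K) • u := fun u => (one_smul K u).symm
  refine ⟨u₀, (s ^ p ^ e)⁻¹ • u₂, s • u₁, j, hj, ?_, ?_, ?_, h00, ?_, ?_, ?_, ?_⟩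
  · rw [hg, Submodule.span_singleton_smul_eq (IsUnit.mk0 _ (inv_ne_zero hsq))]
  · rw [hf, Submodule.span_singleton_smul_eq (IsUnit.mk0 _ hs0)]
  · rw [hermForm_smul_smul, h21, inv_mul_cancel₀ hsq, one_mul]
  · rw [one_s u₀, hermForm_smul_smul, h02, mul_zero]
  · rw [one_s u₀, hermForm_smul_smul, h01, mul_zero]
  · rw [hN, detLine_smul _ _ _ (inv_ne_zero hsq)]
  · rw [hL, detLine_smul _ _ _ hs0, hsj, smul_smul, mul_inv_cancel₀ hsq, one_smul]

theorem unitaryAdj_irrefl (p e r : ℕ) {K : Type*} [Fact p.Prime] [Field K] (lam : K)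
    (f : unitalFlags K (p ^ e)) : ¬ unitaryAdj p e r lam f f := by
  rintro ⟨u₀, u₁, u₂, i, -, hf, hg, h12, -⟩
  have hq0 : p ^ e ≠ 0 := pow_ne_zero _ (Fact.out : p.Prime).ne_zero
  obtain ⟨⟨u, -, huu, hu⟩, -⟩ := f.2
  have m1 : u₁ ∈ Submodule.span K {u} := by
    rw [← hu, hf]; exact Submodule.mem_span_singleton_self u₁
  have m2 : u₂ ∈ Submodule.span K {u} := by
    rw [← hu, hg]; exact Submodule.mem_span_singleton_self u₂
  obtain ⟨a, rfl⟩ := Submodule.mem_span_singleton.1 m1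
  obtain ⟨b, rfl⟩ := Submodule.mem_span_singleton.1 m2
  rw [hermForm_smul_smul, huu, mul_zero] at h12
  exact zero_ne_one h12

/-- The unitary graph with parameters `r`, `lam` over a field `K` of order `q²`, where
`q = p ^ e > 2`, `r` divides `2 e`, and `lam ^ q` lies in the orbit of `lam ≠ 0` under the group
generated by `x ↦ x ^ (p ^ r)`. -/
def unitaryGraph (p e r : ℕ) {K : Type*} [Fact p.Prime] [Field K] [Finite K] [CharP K p]
    (hq : 2 < p ^ e) (hK : Nat.card K = (p ^ e) ^ 2) (hr : r ∣ 2 * e) (lam : K) (h0 : lam ≠ 0)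
    (hlam : lam ^ p ^ e ∈ MulAction.orbit (frobGroup p r K) lam) :
    SimpleGraph (unitalFlags K (p ^ e)) where
  Adj := unitaryAdj p e r lam
  symm := ⟨fun _ _ h => unitaryAdj_symm p e r hq hK hr h0 hlam h⟩
  loopless := ⟨fun f h => unitaryAdj_irrefl p e r lam f h⟩

/-! ### Counting with fibres -/

/-! Write N(x) = x^(q+1), β for the form and O for the orbit of λ. A line of the unital consists of
the absolute points of n^⊥ for some n with β(n,n) = -1, and n is unique up to the q+1 scalars of
norm one (`exists_eq_polarLine`, `polarLine_eq_iff`). A flag is therefore a pair (⟨u⟩, n) with u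
isotropic in n^⊥. By `unitaryAdj_iff`, (⟨u⟩, n) and (⟨v⟩, m) are adjacent exactly when xu - yv = n -
zm for scalars with N(z) = 1 and β(xu, yv) = μ⁻¹ for some μ in O.

Fix (⟨u⟩, n) and m. The relation forces β(u,m) ≠ 0 and z^q β(n,m) = μ⁻¹ - 1, and it then determines
x. Conversely, if β(u,m) ≠ 0, distinct solutions z give distinct neighbours on m^⊥
(`ncard_neighbours`). So neighbours on m^⊥ exist if and only if β(u,m) ≠ 0 and N(β(n,m)) lies in T =
{N(μ⁻¹ - 1) : μ ∈ O}, and their number depends only on β(n,m). By Galois equivariance T is the orbit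
of η = N(λ⁻¹ - 1). If λ ≠ 1, then |T| = l* and the solutions z correspond to a fibre of O → T, so
there are k*/l* of them. If λ = 1, then T = {0} and all q+1 elements of norm one are solutions.

The case distinction comes from `norm_eq_one_of_orthogonal`: β(u,m) = 0 forces N(β(n,m)) = 1. Now 1
∈ T only if η = 1, that is λ + λ^q = 1, and then T = {1}. In all other cases every flag of a block
has neighbours in each adjacent block. If T = {1}, the lines of two adjacent blocks meet in the
point ⟨m + β(m,n) n⟩, and the two flags at this point are the isolated vertices.

For the valencies, write m = an + bu + cw with u, w a hyperbolic pair in n^⊥. The conditions become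
N(a) ∈ T, bc^q + cb^q = N(a) - 1 and c ≠ 0 (or, for the quotient graph, b and c not both zero).
Counting solutions and dividing by q+1 gives (a) and (b). -/

theorem ncard_eq_mul_of_fibers {α β : Type*} [Finite α] [Finite β] {s : Set α} {t : Set β} (f : α → β)
    {n : ℕ} (hst : ∀ a ∈ s, f a ∈ t) (hn : ∀ b ∈ t, {a | a ∈ s ∧ f a = b}.ncard = n) :
    s.ncard = t.ncard * n := by
  classical
  have := Fintype.ofFinite α
  have := Fintype.ofFinite β
  have h := Finset.card_eq_sum_card_fiberwise (f := f) (s := s.toFinset) (t := t.toFinset)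
    (fun a ha => by simpa using hst a (by simpa using ha))
  rw [Set.ncard_eq_toFinset_card', h, Set.ncard_eq_toFinset_card']
  rw [Finset.sum_const_nat (m := n)]
  intro b hb
  rw [← hn b (by simpa using hb), Set.ncard_eq_toFinset_card']
  congr 1
  ext a
  simp

/-- The cardinality of the fibres of an equivariant map restricted to an orbit. -/
theorem ncard_orbit_eq_mul_fiber {G X Y : Type*} [Group G] [MulAction G X] [MulAction G Y]
    [Finite X] [Finite Y] (φ : X → Y) (hφ : ∀ (g : G) (x : X), φ (g • x) = g • φ x) (x : X) {t : Y}
    (ht : t ∈ MulAction.orbit G (φ x)) :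
    (MulAction.orbit G x).ncard =
      (MulAction.orbit G (φ x)).ncard * {y | y ∈ MulAction.orbit G x ∧ φ y = t}.ncard := by
  refine ncard_eq_mul_of_fibers φ ?_ ?_
  · rintro _ ⟨g, rfl⟩
    exact ⟨g, (hφ g x).symm⟩
  · intro b hb
    rw [← MulAction.orbit_eq_iff.2 ht] at hb
    obtain ⟨g, rfl⟩ := hb
    -- Translation by g carries the fibre over t onto the fibre over g • t, so all fibres over the
    -- orbit have the same size.
    have : {a | a ∈ MulAction.orbit G x ∧ φ a = g • t} =
        (fun a => g • a) '' {y | y ∈ MulAction.orbit G x ∧ φ y = t} := by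
      ext a
      constructor
      · rintro ⟨h1, h2⟩
        refine ⟨g⁻¹ • a, ⟨(MulAction.mem_orbit_of_mem_orbit _ h1), ?_⟩, smul_inv_smul g a⟩
        rw [hφ, h2, inv_smul_smul]
      · rintro ⟨y, ⟨h1, h2⟩, rfl⟩
        exact ⟨MulAction.mem_orbit_of_mem_orbit _ h1, by simp only [hφ, h2]⟩
    simp only [this]
    exact Set.ncard_image_of_injective _ (MulAction.injective g)

theorem ncard_orbit_eq_card_div {G X : Type*} [Group G] [MulAction G X] [Finite G] (x : X) :
    (MulAction.orbit G x).ncard = Nat.card G / Nat.card (MulAction.stabilizer G x) := by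
  classical
  have h := (MulAction.stabilizer G x).card_mul_index
  rw [MulAction.index_stabilizer] at h
  rw [← h, Nat.mul_div_cancel_left _ Nat.card_pos]

/-! ### Fields of order `q²` with the involution `x ↦ x ^ q` -/

/-- `K` is a field of order `q ^ 2` and `x ↦ x ^ q` is an additive involution of `K`. -/
structure IsQuadraticFrobenius (K : Type*) [Field K] (q : ℕ) : Prop where
  add_pow : ∀ x y : K, (x + y) ^ q = x ^ q + y ^ q
  pow_pow : ∀ x : K, (x ^ q) ^ q = x
  card : Nat.card K = q ^ 2
  one_lt : 1 < q

theorem isQuadraticFrobenius_of_card {p e : ℕ} {K : Type*} [Fact p.Prime] [Field K] [Finite K]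
    [CharP K p] (hq : 2 < p ^ e) (hK : Nat.card K = (p ^ e) ^ 2) :
    IsQuadraticFrobenius K (p ^ e) where
  add_pow x y := add_pow_char_pow x y p e
  pow_pow x := by
    have := Fintype.ofFinite K
    have h := FiniteField.pow_card x
    rw [← Nat.card_eq_fintype_card, hK, pow_two, pow_mul] at h
    exact h
  card := hK
  one_lt := by omega

namespace IsQuadraticFrobenius

variable {K : Type*} [Field K] {q : ℕ}

theorem ne_zero (hF : IsQuadraticFrobenius K q) : q ≠ 0 := by
  have := hF.one_lt; omega

theorem finite (hF : IsQuadraticFrobenius K q) : Finite K :=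
  Nat.finite_of_card_ne_zero (by rw [hF.card]; exact pow_ne_zero _ hF.ne_zero)

theorem zero_pow (hF : IsQuadraticFrobenius K q) : (0 : K) ^ q = 0 := _root_.zero_pow hF.ne_zero

theorem neg_pow (hF : IsQuadraticFrobenius K q) (x : K) : (-x) ^ q = -x ^ q := by
  have h := hF.add_pow (-x) x
  rw [neg_add_cancel, hF.zero_pow] at h
  exact eq_neg_of_add_eq_zero_left h.symm

theorem sub_pow (hF : IsQuadraticFrobenius K q) (x y : K) : (x - y) ^ q = x ^ q - y ^ q := by
  rw [sub_eq_add_neg, hF.add_pow, hF.neg_pow, sub_eq_add_neg]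

theorem pow_succ_pow (hF : IsQuadraticFrobenius K q) (x : K) :
    (x ^ (q + 1)) ^ q = x ^ (q + 1) := by
  rw [pow_succ, mul_pow, hF.pow_pow, mul_comm]

theorem neg_pow_succ (hF : IsQuadraticFrobenius K q) (x : K) : (-x) ^ (q + 1) = x ^ (q + 1) := by
  rw [pow_succ, hF.neg_pow, neg_mul_neg, ← pow_succ]

theorem pow_pow_succ (hF : IsQuadraticFrobenius K q) (x : K) :
    (x ^ q) ^ (q + 1) = x ^ (q + 1) := by
  rw [pow_succ, hF.pow_pow, mul_comm, ← pow_succ]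

theorem mul_pow_of_norm_eq_one {z : K} (hz : z ^ (q + 1) = 1) : z * z ^ q = 1 := by
  rwa [pow_succ'] at hz

theorem ncard_ne_zero (hF : IsQuadraticFrobenius K q) : {x : K | x ≠ 0}.ncard = q ^ 2 - 1 := by
  have := hF.finite
  have h := Set.ncard_add_ncard_compl ({0} : Set K)
  rw [hF.card, Set.ncard_singleton] at h
  change ({0}ᶜ : Set K).ncard = _
  omega

/-- Every element fixed by the involution has exactly `q` representations as a trace. -/
theorem ncard_trace_eq (hF : IsQuadraticFrobenius K q) {s : K} (hs : s ^ q = s) :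
    {x : K | x + x ^ q = s}.ncard = q := by
  have := hF.finite
  have := Fintype.ofFinite K
  classical
  -- With f(x) = x + x^q and g(x) = x^q - x, the image of f lies in the kernel of g. Both kernels
  -- have at most q elements, being root sets of polynomials of degree q, while |ker f| |im f| = q².
  -- Hence |ker f| = |im f| = q and im f = ker g, which contains s; the wanted set is a coset of ker
  -- f.
  let φ : K →+ K := AddMonoidHom.mk' (fun x => x ^ q) hF.add_pow
  let f : K →+ K := AddMonoidHom.id K + φ
  let g : K →+ K := φ - AddMonoidHom.id K
  have hf : ∀ x, f x = x + x ^ q := fun x => rfl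
  have hg : ∀ x, g x = x ^ q - x := fun x => rfl
  have bound : ∀ (P : Polynomial K) (S : AddSubgroup K), P ≠ 0 → P.natDegree ≤ q →
      (∀ x ∈ S, P.eval x = 0) → Nat.card S ≤ q := by
    intro P S h0 hd h
    have h1 : (S : Set K) ⊆ (P.roots.toFinset : Set K) := by
      intro x hx
      simp only [Finset.mem_coe, Multiset.mem_toFinset, Polynomial.mem_roots h0,
        Polynomial.IsRoot]
      exact h x hx
    have h2 := Set.ncard_le_ncard h1
    rw [Set.ncard_coe_finset] at h2
    calc Nat.card S = (S : Set K).ncard := rfl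
      _ ≤ _ := h2
      _ ≤ P.roots.card := Multiset.toFinset_card_le _
      _ ≤ _ := (Polynomial.card_roots' P).trans hd
  have hkf : Nat.card f.ker ≤ q := by
    refine bound (Polynomial.X ^ q + Polynomial.X) _ ?_ ?_ ?_
    · exact (Polynomial.monic_X_pow_add (by
        rw [Polynomial.degree_X]; exact_mod_cast hF.one_lt)).ne_zero
    · exact (Polynomial.natDegree_add_le _ _).trans (by
        have := hF.one_lt
        simp; omega)
    · intro x hx
      have : x + x ^ q = 0 := hx
      simp only [Polynomial.eval_add, Polynomial.eval_pow, Polynomial.eval_X]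
      rwa [add_comm]
  have hkg : Nat.card g.ker ≤ q := by
    refine bound (Polynomial.X ^ q - Polynomial.X) _ ?_ ?_ ?_
    · exact FiniteField.X_pow_card_sub_X_ne_zero K hF.one_lt
    · exact (FiniteField.X_pow_card_sub_X_natDegree_eq K hF.one_lt).le
    · intro x hx
      have : x ^ q - x = 0 := hx
      simpa using this
  have hle : f.range ≤ g.ker := by
    rintro _ ⟨x, rfl⟩
    change (x + x ^ q) ^ q - (x + x ^ q) = 0
    rw [hF.add_pow, hF.pow_pow]
    ring
  have hcard := f.ker.card_mul_index
  rw [AddSubgroup.index_ker, hF.card] at hcard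
  have hrg : Nat.card f.range ≤ Nat.card g.ker := AddSubgroup.card_le_of_le hle
  have hq0 := hF.one_lt
  have hker : Nat.card f.ker = q := by nlinarith
  have hran : Nat.card f.range = q := by
    rw [hker, pow_two] at hcard
    exact Nat.eq_of_mul_eq_mul_left (by omega) hcard
  have heq : f.range = g.ker := AddSubgroup.eq_of_le_of_card_ge hle (by omega)
  have hsg : s ∈ g.ker := by
    change s ^ q - s = 0
    rw [hs, sub_self]
  rw [← heq] at hsg
  obtain ⟨a, ha⟩ := hsg
  have : {x : K | x + x ^ q = s} = (fun x => x + a) '' (f.ker : Set K) := by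
    ext x
    constructor
    · intro hx
      refine ⟨x - a, ?_, sub_add_cancel x a⟩
      change f (x - a) = 0
      rw [map_sub, ha]
      exact sub_eq_zero.2 hx
    · rintro ⟨y, hy, rfl⟩
      change f (y + a) = s
      rw [map_add, ha, show f y = 0 from hy, zero_add]
  rw [this, Set.ncard_image_of_injective _ (add_left_injective a)]
  exact hker

theorem exists_trace_eq (hF : IsQuadraticFrobenius K q) {s : K} (hs : s ^ q = s) :
    ∃ x : K, x + x ^ q = s := by
  have h := hF.ncard_trace_eq hs
  have : {x : K | x + x ^ q = s}.Nonempty := by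
    apply Set.nonempty_of_ncard_ne_zero
    rw [h]
    exact hF.ne_zero
  exact this

/-- The unit group is cyclic of order (q-1)(q+1), so the kernel of the (q+1)-st power map has order
q+1. -/
theorem ncard_norm_eq_one (hF : IsQuadraticFrobenius K q) :
    {x : K | x ^ (q + 1) = 1}.ncard = q + 1 := by
  have := hF.finite
  have := Fintype.ofFinite K
  classical
  have hc : Nat.card Kˣ = (q - 1) * (q + 1) := by
    rw [Nat.card_units, hF.card]
    have := hF.one_lt
    obtain ⟨n, rfl⟩ : ∃ n, q = n + 1 := ⟨q - 1, by omega⟩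
    simp only [Nat.add_sub_cancel]
    rw [show (n + 1) ^ 2 = n * (n + 1 + 1) + 1 by ring]
    rfl
  have h1 := (powMonoidHom (q + 1) : Kˣ →* Kˣ).ker.card_mul_index
  rw [IsCyclic.index_powMonoidHom_ker, hc, Nat.gcd_eq_right (Dvd.intro_left _ rfl),
    Nat.mul_div_cancel _ (by omega), mul_comm] at h1
  have h2 := Nat.eq_of_mul_eq_mul_left (by have := hF.one_lt; omega) h1
  have : {x : K | x ^ (q + 1) = 1} =
      (Units.val) '' ((powMonoidHom (q + 1) : Kˣ →* Kˣ).ker : Set Kˣ) := by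
    ext x
    constructor
    · intro hx
      have hx0 : x ≠ 0 := by
        rintro rfl
        simp at hx
      refine ⟨Units.mk0 x hx0, ?_, rfl⟩
      change (Units.mk0 x hx0) ^ (q + 1) = 1
      ext
      simpa using hx
    · rintro ⟨u, hu, rfl⟩
      have hu' : u ^ (q + 1) = 1 := hu
      have := congrArg Units.val hu'
      simpa using this
  rw [this, Set.ncard_image_of_injective _ Units.val_injective]
  exact h2

theorem ncard_norm_eq (hF : IsQuadraticFrobenius K q) {a : K} (ha : a ≠ 0) :
    {x : K | x ^ (q + 1) = a ^ (q + 1)}.ncard = q + 1 := by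
  have : {x : K | x ^ (q + 1) = a ^ (q + 1)} = (fun x => x * a) '' {x : K | x ^ (q + 1) = 1} := by
    ext x
    constructor
    · intro hx
      refine ⟨x / a, ?_, div_mul_cancel₀ x ha⟩
      have hx' : x ^ (q + 1) = a ^ (q + 1) := hx
      change (x / a) ^ (q + 1) = 1
      rw [div_pow, hx', div_self (pow_ne_zero _ ha)]
    · rintro ⟨y, hy, rfl⟩
      have hy' : y ^ (q + 1) = 1 := hy
      change (y * a) ^ (q + 1) = _
      rw [mul_pow, hy', one_mul]
  rw [this, Set.ncard_image_of_injective _ (mul_left_injective₀ ha), hF.ncard_norm_eq_one]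

/-- The number of elements whose norm lies in a given set of nonzero norms. -/
theorem ncard_norm_mem (hF : IsQuadraticFrobenius K q) {T : Set K}
    (hT : ∀ t ∈ T, ∃ a : K, a ≠ 0 ∧ t = a ^ (q + 1)) :
    {x : K | x ^ (q + 1) ∈ T}.ncard = T.ncard * (q + 1) := by
  have := hF.finite
  refine ncard_eq_mul_of_fibers (fun x => x ^ (q + 1)) (fun a ha => ha) ?_
  rintro b hb
  obtain ⟨a, ha, rfl⟩ := hT b hb
  refine Eq.trans (congrArg Set.ncard ?_) (hF.ncard_norm_eq ha)
  ext x
  refine ⟨fun h => h.2, fun h => ⟨?_, h⟩⟩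
  change x ^ (q + 1) ∈ T
  rwa [show x ^ (q + 1) = a ^ (q + 1) from h]

/-- The number of vectors `(x, y)` of a hyperbolic plane of given norm with `y ≠ 0`. -/
theorem ncard_hyperbolic (hF : IsQuadraticFrobenius K q) {s : K} (hs : s ^ q = s) :
    {c : K × K | c.2 ≠ 0 ∧ c.1 * c.2 ^ q + c.2 * c.1 ^ q = s}.ncard = (q ^ 2 - 1) * q := by
  have := hF.finite
  rw [← hF.ncard_ne_zero]
  refine ncard_eq_mul_of_fibers Prod.snd (fun a ha => ha.1) ?_
  intro y hy
  have hy' : y ≠ 0 := hy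
  have hyq : y ^ q ≠ 0 := pow_ne_zero _ hy'
  refine Eq.trans ?_ (hF.ncard_trace_eq hs)
  -- For fixed y ≠ 0 the substitution z = x y^q turns the equation into z + z^q = s.
  refine Set.ncard_congr (fun c _ => c.1 * y ^ q) ?_ ?_ ?_
  · rintro ⟨x, y'⟩ ⟨⟨-, h2⟩, rfl⟩
    change x * y' ^ q + (x * y' ^ q) ^ q = s
    rw [mul_pow, hF.pow_pow, ← h2]
    ring
  · rintro ⟨x, y1⟩ ⟨x', y2⟩ ⟨-, h1⟩ ⟨-, h2⟩ h
    rw [mul_left_inj' hyq] at h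
    exact Prod.ext h (h1.trans h2.symm)
  · intro z hz
    have hz' : z + z ^ q = s := hz
    refine ⟨(z / y ^ q, y), ⟨⟨hy', ?_⟩, rfl⟩, ?_⟩
    · change z / y ^ q * y ^ q + y * (z / y ^ q) ^ q = s
      rw [div_mul_cancel₀ _ hyq, div_pow, hF.pow_pow, mul_div_cancel₀ _ hy', hz']
    · exact div_mul_cancel₀ _ hyq

end IsQuadraticFrobenius

/-! ### The Hermitian form -/

section HermitianForm

variable {K : Type*} [Field K] {q : ℕ}

theorem hermForm_smul_left (a : K) (u v : Fin 3 → K) :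
    hermForm q (a • u) v = a * hermForm q u v := by
  simp only [hermForm, Pi.smul_apply, smul_eq_mul]
  ring

theorem hermForm_smul_right (a : K) (u v : Fin 3 → K) :
    hermForm q u (a • v) = a ^ q * hermForm q u v := by
  simp only [hermForm, Pi.smul_apply, smul_eq_mul, mul_pow]
  ring

theorem hermForm_add_left (u v w : Fin 3 → K) :
    hermForm q (u + v) w = hermForm q u w + hermForm q v w := by
  simp only [hermForm, Pi.add_apply]
  ring

theorem hermForm_sub_left (u v w : Fin 3 → K) :
    hermForm q (u - v) w = hermForm q u w - hermForm q v w := by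
  simp only [hermForm, Pi.sub_apply]
  ring

theorem hermForm_smul_self {z : K} (hz : z ^ (q + 1) = 1) (n : Fin 3 → K) :
    hermForm q (z • n) (z • n) = hermForm q n n := by
  rw [hermForm_smul_smul, ← pow_succ', hz, one_mul]

theorem hermForm_zero_left (w : Fin 3 → K) : hermForm q 0 w = 0 := by
  simp [hermForm]

namespace IsQuadraticFrobenius

theorem hermForm_add_right (hF : IsQuadraticFrobenius K q) (u v w : Fin 3 → K) :
    hermForm q u (v + w) = hermForm q u v + hermForm q u w := by
  simp only [hermForm, Pi.add_apply, hF.add_pow]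
  ring

theorem hermForm_sub_right (hF : IsQuadraticFrobenius K q) (u v w : Fin 3 → K) :
    hermForm q u (v - w) = hermForm q u v - hermForm q u w := by
  simp only [hermForm, Pi.sub_apply, hF.sub_pow]
  ring

theorem hermForm_comm (hF : IsQuadraticFrobenius K q) (u v : Fin 3 → K) :
    hermForm q v u = hermForm q u v ^ q := by
  simp only [hermForm, hF.add_pow, hF.neg_pow, mul_pow, hF.pow_pow]
  ring

theorem hermForm_eq_zero_comm (hF : IsQuadraticFrobenius K q) {u v : Fin 3 → K}
    (h : hermForm q u v = 0) : hermForm q v u = 0 := by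
  rw [hF.hermForm_comm, h, hF.zero_pow]

theorem hermForm_self_pow (hF : IsQuadraticFrobenius K q) (u : Fin 3 → K) :
    hermForm q u u ^ q = hermForm q u u := (hF.hermForm_comm u u).symm

theorem exists_hermForm_ne_zero (hF : IsQuadraticFrobenius K q) {u : Fin 3 → K} (hu : u ≠ 0) :
    ∃ c, hermForm q u c ≠ 0 := by
  by_contra! h
  apply hu
  have h0 := h ![1, 0, 0]
  have h1 := h ![0, 1, 0]
  have h2 := h ![0, 0, 1]
  simp [hermForm, hF.zero_pow] at h0 h1 h2
  ext i
  fin_cases i <;> simp [h0, h1, h2]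

/-- There are no totally isotropic subspaces of dimension two. -/
theorem mem_span_of_isotropic (hF : IsQuadraticFrobenius K q) {u v : Fin 3 → K} (hu : u ≠ 0)
    (huu : hermForm q u u = 0) (hvv : hermForm q v v = 0) (hvu : hermForm q v u = 0) :
    ∃ a : K, v = a • u := by
  -- An isotropic vector with last coordinate 0 is a multiple of (0, 1, 0). This settles the case u
  -- 2 = 0; otherwise v is reduced to this case by subtracting a multiple of u.
  have key : ∀ w : Fin 3 → K, hermForm q w w = 0 → w 2 = 0 → w 0 = 0 := by
    intro w hw h2
    simp only [hermForm, h2, hF.zero_pow, mul_zero, zero_mul, add_zero, neg_eq_zero] at hw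
    rcases mul_eq_zero.1 hw with h | h
    · exact h
    · exact eq_zero_of_pow_eq_zero h
  by_cases h2 : u 2 = 0
  · have h0 := key u huu h2
    have h1 : u 1 ≠ 0 := by
      intro h1
      apply hu
      ext i
      fin_cases i <;> simp [h0, h1, h2]
    have hv2 : v 2 = 0 := by
      simp only [hermForm, h2, h0, hF.zero_pow, mul_zero, neg_zero, zero_add] at hvu
      exact (mul_eq_zero.1 hvu).resolve_right (pow_ne_zero _ h1)
    have hv0 := key v hvv hv2
    refine ⟨v 1 / u 1, ?_⟩
    ext i
    fin_cases i <;> simp [h0, h1, h2, hv2, hv0]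
  · refine ⟨v 2 / u 2, ?_⟩
    set d := v - (v 2 / u 2) • u with hd
    have huv := hF.hermForm_eq_zero_comm hvu
    have d2 : d 2 = 0 := by simp [hd, h2]
    have dd : hermForm q d d = 0 := by
      simp only [hd, hermForm_sub_left, hF.hermForm_sub_right, hermForm_smul_left,
        hermForm_smul_right, huu, hvv, hvu, huv]
      ring
    have du : hermForm q d u = 0 := by
      simp only [hd, hermForm_sub_left, hermForm_smul_left, huu, hvu]
      ring
    have d0 := key d dd d2
    have d1 : d 1 = 0 := by
      simp only [hermForm, d0, d2, zero_mul, neg_zero, zero_add, add_zero] at du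
      exact (mul_eq_zero.1 du).resolve_right (pow_ne_zero _ h2)
    have : d = 0 := by
      ext i
      fin_cases i <;> simp [d0, d1, d2]
    exact sub_eq_zero.1 this

end IsQuadraticFrobenius

/-! ### Hyperbolic frames and coordinates -/

/-- A basis `n, u, w` with `n` of norm `-1` orthogonal to the hyperbolic pair `u, w`. -/
structure IsHyperbolicFrame (q : ℕ) (n u w : Fin 3 → K) : Prop where
  nn : hermForm q n n = -1
  un : hermForm q u n = 0
  wn : hermForm q w n = 0
  uu : hermForm q u u = 0
  ww : hermForm q w w = 0
  uw : hermForm q u w = 1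

/-- The vector with given coordinates in a frame. -/
def frameVector (n u w : Fin 3 → K) (c : K × K × K) : Fin 3 → K :=
  c.1 • n + c.2.1 • u + c.2.2 • w

namespace IsHyperbolicFrame

variable {n u w : Fin 3 → K}

theorem nu (hF : IsQuadraticFrobenius K q) (h : IsHyperbolicFrame q n u w) :
    hermForm q n u = 0 := hF.hermForm_eq_zero_comm h.un

theorem nw (hF : IsQuadraticFrobenius K q) (h : IsHyperbolicFrame q n u w) :
    hermForm q n w = 0 := hF.hermForm_eq_zero_comm h.wn

theorem wu (hF : IsQuadraticFrobenius K q) (h : IsHyperbolicFrame q n u w) :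
    hermForm q w u = 1 := by rw [hF.hermForm_comm, h.uw, one_pow]

theorem u_ne_zero (h : IsHyperbolicFrame q n u w) : u ≠ 0 := by
  rintro rfl
  have := h.uw
  rw [hermForm_zero_left] at this
  exact zero_ne_one this

theorem frameVector_left_n (h : IsHyperbolicFrame q n u w)
    (c : K × K × K) : hermForm q (frameVector n u w c) n = -c.1 := by
  simp only [frameVector, hermForm_add_left, hermForm_smul_left, h.nn, h.un, h.wn]
  ring

theorem frameVector_left_u (hF : IsQuadraticFrobenius K q) (h : IsHyperbolicFrame q n u w)
    (c : K × K × K) : hermForm q (frameVector n u w c) u = c.2.2 := by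
  simp only [frameVector, hermForm_add_left, hermForm_smul_left, h.nu hF, h.uu, h.wu hF]
  ring

theorem frameVector_left_w (hF : IsQuadraticFrobenius K q) (h : IsHyperbolicFrame q n u w)
    (c : K × K × K) : hermForm q (frameVector n u w c) w = c.2.1 := by
  simp only [frameVector, hermForm_add_left, hermForm_smul_left, h.nw hF, h.uw, h.ww]
  ring

theorem frameVector_self (hF : IsQuadraticFrobenius K q) (h : IsHyperbolicFrame q n u w)
    (c : K × K × K) : hermForm q (frameVector n u w c) (frameVector n u w c) =
      -c.1 ^ (q + 1) + (c.2.1 * c.2.2 ^ q + c.2.2 * c.2.1 ^ q) := by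
  have key : ∀ v, hermForm q v (frameVector n u w c) = c.1 ^ q * hermForm q v n +
      c.2.1 ^ q * hermForm q v u + c.2.2 ^ q * hermForm q v w := fun v => by
    simp only [frameVector, hF.hermForm_add_right, hermForm_smul_right]
  rw [key, h.frameVector_left_n, h.frameVector_left_u hF, h.frameVector_left_w hF]
  ring

theorem frameVector_injective (hF : IsQuadraticFrobenius K q) (h : IsHyperbolicFrame q n u w) :
    Function.Injective (frameVector n u w) := by
  intro c d hcd
  have h1 := h.frameVector_left_n c
  have h2 := h.frameVector_left_u hF c
  have h3 := h.frameVector_left_w hF c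
  rw [hcd] at h1 h2 h3
  rw [h.frameVector_left_n] at h1
  rw [h.frameVector_left_u hF] at h2
  rw [h.frameVector_left_w hF] at h3
  exact Prod.ext (neg_injective h1.symm) (Prod.ext h3.symm h2.symm)

/-- An injective map between finite sets of the same size |K|³ is surjective. -/
theorem frameVector_surjective (hF : IsQuadraticFrobenius K q) (h : IsHyperbolicFrame q n u w) :
    Function.Surjective (frameVector n u w) := by
  have := hF.finite
  have hb := (Nat.bijective_iff_injective_and_card (frameVector n u w)).2
    ⟨h.frameVector_injective hF, by
      rw [Nat.card_prod, Nat.card_prod, Nat.card_fun, Nat.card_eq_fintype_card (α := Fin 3),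
        Fintype.card_fin]
      ring⟩
  exact hb.2

/-- A vector orthogonal to the hyperbolic pair is a multiple of `n`. -/
theorem eq_smul (hF : IsQuadraticFrobenius K q) (h : IsHyperbolicFrame q n u w) {m : Fin 3 → K}
    (hu : hermForm q m u = 0) (hw : hermForm q m w = 0) : ∃ a : K, m = a • n := by
  obtain ⟨c, rfl⟩ := h.frameVector_surjective hF m
  rw [h.frameVector_left_u hF] at hu
  rw [h.frameVector_left_w hF] at hw
  exact ⟨c.1, by simp [frameVector, hu, hw]⟩

/-- The vectors orthogonal to `n` are the combinations of the hyperbolic pair. -/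
theorem exists_of_orthogonal (hF : IsQuadraticFrobenius K q) (h : IsHyperbolicFrame q n u w)
    {x : Fin 3 → K} (hx : hermForm q x n = 0) : ∃ a b : K, x = a • u + b • w := by
  obtain ⟨c, rfl⟩ := h.frameVector_surjective hF x
  rw [h.frameVector_left_n, neg_eq_zero] at hx
  exact ⟨c.2.1, c.2.2, by simp [frameVector, hx]⟩

end IsHyperbolicFrame

namespace IsQuadraticFrobenius

/-- An isotropic vector orthogonal to a vector of norm `-1` is part of a frame. -/
theorem exists_frame (hF : IsQuadraticFrobenius K q) {n u : Fin 3 → K} (hn : hermForm q n n = -1)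
    (hu : u ≠ 0) (huu : hermForm q u u = 0) (hun : hermForm q u n = 0) :
    ∃ w, IsHyperbolicFrame q n u w := by
  obtain ⟨c, hc⟩ := hF.exists_hermForm_ne_zero hu
  -- The orthogonal projection of c to n^⊥; the sign is + because n has norm -1. The pairing with u
  -- is unchanged.
  set d := c + hermForm q c n • n with hd
  have hdn : hermForm q d n = 0 := by
    simp only [hd, hermForm_add_left, hermForm_smul_left, hn]
    ring
  have hud : hermForm q u d ≠ 0 := by
    simpa only [hd, hF.hermForm_add_right, hermForm_smul_right, hun, mul_zero, add_zero] using hc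
  set b := (hermForm q d u)⁻¹ • d with hb
  have hdu : hermForm q d u ≠ 0 := by
    rw [hF.hermForm_comm]
    exact pow_ne_zero _ hud
  have hbu : hermForm q b u = 1 := by
    rw [hb, hermForm_smul_left, inv_mul_cancel₀ hdu]
  have hub : hermForm q u b = 1 := by rw [hF.hermForm_comm, hbu, one_pow]
  have hbn : hermForm q b n = 0 := by rw [hb, hermForm_smul_left, hdn, mul_zero]
  -- Since β(b,u) = 1, the vector b + tu has norm β(b,b) + t + t^q, so a suitable trace makes it
  -- isotropic.
  obtain ⟨t, ht⟩ := hF.exists_trace_eq (s := -hermForm q b b)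
    (by rw [hF.neg_pow, hF.hermForm_self_pow])
  refine ⟨b + t • u, hn, hun, ?_, huu, ?_, ?_⟩
  · rw [hermForm_add_left, hermForm_smul_left t, hbn, hun, mul_zero, add_zero]
  · simp only [hermForm_add_left, hF.hermForm_add_right, hermForm_smul_left, hermForm_smul_right,
      hbu, hub, huu]
    linear_combination ht
  · rw [hF.hermForm_add_right, hermForm_smul_right t, hub, huu, mul_zero, add_zero]

theorem exists_isotropic (hF : IsQuadraticFrobenius K q) {n : Fin 3 → K}
    (hn : hermForm q n n = -1) :
    ∃ u, u ≠ 0 ∧ hermForm q u u = 0 ∧ hermForm q u n = 0 := by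
  by_cases h1 : n 1 = 0
  · refine ⟨![0, 0, 1], ?_, ?_, ?_⟩
    · intro h
      simpa using congrFun h 2
    · simp [hermForm, hF.zero_pow]
    · simp [hermForm, h1, hF.zero_pow]
  · have hq1 : n 1 ^ q ≠ 0 := pow_ne_zero _ h1
    -- This is n + d with d = (1, 0, t), where t is chosen so that β(d,n) = 1. As β(d,d) = -1, the
    -- sum is isotropic and orthogonal to n.
    refine ⟨![n 0 + 1, n 1, n 2 + (1 + n 0 ^ q) / n 1 ^ q], ?_, ?_, ?_⟩
    · intro h
      exact h1 (by simpa using congrFun h 1)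
    · simp only [hermForm, Matrix.cons_val_zero, Matrix.cons_val_one, Matrix.cons_val,
        hF.add_pow, div_pow, hF.pow_pow, one_pow] at hn ⊢
      field_simp
      linear_combination hn
    · simp only [hermForm, Matrix.cons_val_zero, Matrix.cons_val_one, Matrix.cons_val] at hn ⊢
      field_simp
      linear_combination hn

theorem exists_frame_of_norm (hF : IsQuadraticFrobenius K q) {n : Fin 3 → K}
    (hn : hermForm q n n = -1) : ∃ u w, IsHyperbolicFrame q n u w := by
  obtain ⟨u, h0, h1, h2⟩ := hF.exists_isotropic hn
  obtain ⟨w, h⟩ := hF.exists_frame hn h0 h1 h2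
  exact ⟨u, w, h⟩

end IsQuadraticFrobenius

/-! ### The unitary cross product -/

/-- The vector representing the linear form `x ↦ det (x, v, w)`. -/
def detPolar (q : ℕ) (v w : Fin 3 → K) : Fin 3 → K :=
  ![-(v 1 * w 2 - v 2 * w 1) ^ q, (v 0 * w 1 - v 1 * w 0) ^ q, (v 2 * w 0 - v 0 * w 2) ^ q]

namespace IsQuadraticFrobenius

theorem det_eq_hermForm_detPolar (hF : IsQuadraticFrobenius K q) (x v w : Fin 3 → K) :
    Matrix.det !![x 0, v 0, w 0; x 1, v 1, w 1; x 2, v 2, w 2] =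
      hermForm q x (detPolar q v w) := by
  simp only [hermForm, detPolar, Matrix.det_fin_three, Matrix.of_apply,
    Matrix.cons_val', Matrix.cons_val_zero, Matrix.cons_val_one, Matrix.cons_val, hF.neg_pow,
    hF.pow_pow]
  ring

theorem hermForm_left_detPolar (hF : IsQuadraticFrobenius K q) (v w : Fin 3 → K) :
    hermForm q v (detPolar q v w) = 0 := by
  simp only [hermForm, detPolar, Matrix.cons_val_zero, Matrix.cons_val_one, Matrix.cons_val,
    hF.neg_pow, hF.pow_pow]
  ring

theorem hermForm_right_detPolar (hF : IsQuadraticFrobenius K q) (v w : Fin 3 → K) :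
    hermForm q w (detPolar q v w) = 0 := by
  simp only [hermForm, detPolar, Matrix.cons_val_zero, Matrix.cons_val_one, Matrix.cons_val,
    hF.neg_pow, hF.pow_pow]
  ring

/-- The unitary form of Lagrange's identity: the norm of the cross product is the Gram determinant.
-/
theorem hermForm_detPolar (hF : IsQuadraticFrobenius K q) (v w : Fin 3 → K) :
    hermForm q (detPolar q v w) (detPolar q v w) =
      hermForm q v v * hermForm q w w - hermForm q v w * hermForm q w v := by
  simp only [hermForm, detPolar, Matrix.cons_val_zero, Matrix.cons_val_one, Matrix.cons_val,
    hF.neg_pow, hF.pow_pow, hF.sub_pow, mul_pow]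
  ring

end IsQuadraticFrobenius

/-! ### Lines of the unital as polars of vectors of norm `-1` -/

/-- The absolute points orthogonal to `n`. -/
def polarLine (q : ℕ) (n : Fin 3 → K) : Set (Submodule K (Fin 3 → K)) :=
  {P | P ∈ absolutePoints K q ∧ ∀ x ∈ P, hermForm q x n = 0}

theorem span_mem_absolutePoints {u : Fin 3 → K} (hu : u ≠ 0) (huu : hermForm q u u = 0) :
    Submodule.span K {u} ∈ absolutePoints K q := ⟨u, hu, huu, rfl⟩

theorem span_mem_polarLine_iff {u n : Fin 3 → K} (hu : u ≠ 0) (huu : hermForm q u u = 0) :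
    Submodule.span K {u} ∈ polarLine q n ↔ hermForm q u n = 0 := by
  constructor
  · intro h
    exact h.2 u (Submodule.mem_span_singleton_self u)
  · intro h
    refine ⟨span_mem_absolutePoints hu huu, fun x hx => ?_⟩
    obtain ⟨a, rfl⟩ := Submodule.mem_span_singleton.1 hx
    rw [hermForm_smul_left, h, mul_zero]

theorem polarLine_smul {a : K} (ha : a ≠ 0) (n : Fin 3 → K) :
    polarLine q (a • n) = polarLine q n := by
  unfold polarLine
  ext P
  simp [hermForm_smul_right, ha]

theorem span_eq_span_iff_exists_smul {u v : Fin 3 → K} (hv : v ≠ 0) :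
    Submodule.span K {u} = Submodule.span K {v} ↔ ∃ a : K, a ≠ 0 ∧ v = a • u := by
  constructor
  · intro h
    have : v ∈ Submodule.span K {u} := h ▸ Submodule.mem_span_singleton_self v
    obtain ⟨a, rfl⟩ := Submodule.mem_span_singleton.1 this
    exact ⟨a, fun h0 => hv (by rw [h0, zero_smul]), rfl⟩
  · rintro ⟨a, ha, rfl⟩
    exact (Submodule.span_singleton_smul_eq (IsUnit.mk0 a ha) u).symm

theorem IsHyperbolicFrame.symm (hF : IsQuadraticFrobenius K q) {n u w : Fin 3 → K}
    (h : IsHyperbolicFrame q n u w) : IsHyperbolicFrame q n w u :=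
  ⟨h.nn, h.wn, h.un, h.ww, h.uu, h.wu hF⟩

theorem IsHyperbolicFrame.polarLine_mem (hF : IsQuadraticFrobenius K q) {n u w : Fin 3 → K}
    (h : IsHyperbolicFrame q n u w) : polarLine q n ∈ unitalLines K q := by
  refine ⟨u, w, ?_, h.uu, h.ww, ?_⟩
  · rw [LinearIndependent.pair_iff]
    intro s t hst
    have := h.frameVector_injective hF (a₁ := (0, s, t)) (a₂ := (0, 0, 0))
      (by simpa [frameVector] using hst)
    simpa using this
  · ext P
    refine and_congr_right fun _ => ⟨fun hP x hx => ?_, fun hP x hx => ?_⟩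
    · obtain ⟨a, b, rfl⟩ := h.exists_of_orthogonal hF (hP x hx)
      exact Submodule.mem_span_pair.2 ⟨a, b, rfl⟩
    · obtain ⟨a, b, rfl⟩ := Submodule.mem_span_pair.1 (hP hx)
      rw [hermForm_add_left, hermForm_smul_left, hermForm_smul_left, h.un, h.wn]
      ring

namespace IsQuadraticFrobenius

theorem polarLine_mem_unitalLines (hF : IsQuadraticFrobenius K q) {n : Fin 3 → K}
    (hn : hermForm q n n = -1) : polarLine q n ∈ unitalLines K q := by
  obtain ⟨u, w, h⟩ := hF.exists_frame_of_norm hn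
  exact h.polarLine_mem hF

/-- The cross product of the two spanning vectors has norm -N(c) with c = β(u,v). Here c ≠ 0 because
independent isotropic vectors cannot be orthogonal, so division by c gives norm -1. -/
theorem exists_eq_polarLine (hF : IsQuadraticFrobenius K q) {L : Set (Submodule K (Fin 3 → K))}
    (hL : L ∈ unitalLines K q) : ∃ n, hermForm q n n = -1 ∧ L = polarLine q n := by
  obtain ⟨u, v, hi, huu, hvv, rfl⟩ := hL
  have hu : u ≠ 0 := hi.ne_zero 0
  have hc : hermForm q u v ≠ 0 := by
    intro h
    obtain ⟨a, ha⟩ := hF.mem_span_of_isotropic hu huu hvv (hF.hermForm_eq_zero_comm h)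
    have := LinearIndependent.pair_iff.1 hi a (-1) (by rw [ha, neg_one_smul, add_neg_cancel])
    simp at this
  set c := hermForm q u v with hcdef
  have hn : hermForm q (c⁻¹ • detPolar q u v) (c⁻¹ • detPolar q u v) = -1 := by
    rw [hermForm_smul_left, hermForm_smul_right, hF.hermForm_detPolar, huu, hvv,
      hF.hermForm_comm u v, ← hcdef]
    have : c ^ q ≠ 0 := pow_ne_zero _ hc
    rw [inv_pow]
    field_simp
    ring
  have hun : hermForm q u (c⁻¹ • detPolar q u v) = 0 := by
    rw [hermForm_smul_right, hF.hermForm_left_detPolar, mul_zero]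
  have hvn : hermForm q v (c⁻¹ • detPolar q u v) = 0 := by
    rw [hermForm_smul_right, hF.hermForm_right_detPolar, mul_zero]
  set n := c⁻¹ • detPolar q u v
  have hcv : hermForm q u ((c⁻¹) ^ q • v) = 1 := by
    rw [hermForm_smul_right, hF.pow_pow, ← hcdef, inv_mul_cancel₀ hc]
  have hfr : IsHyperbolicFrame q n u ((c⁻¹) ^ q • v) :=
    ⟨hn, hun, by rw [hermForm_smul_left, hvn, mul_zero], huu,
      by rw [hermForm_smul_left, hermForm_smul_right, hvv, mul_zero, mul_zero], hcv⟩
  refine ⟨n, hn, ?_⟩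
  ext P
  refine and_congr_right fun _ => ⟨fun hP x hx => ?_, fun hP x hx => ?_⟩
  · obtain ⟨a, b, rfl⟩ := Submodule.mem_span_pair.1 (hP hx)
    rw [hermForm_add_left, hermForm_smul_left, hermForm_smul_left, hun, hvn]
    ring
  · obtain ⟨a, b, rfl⟩ := hfr.exists_of_orthogonal hF (hP x hx)
    rw [smul_smul]
    exact Submodule.mem_span_pair.2 ⟨a, _, rfl⟩

theorem polarLine_eq_iff (hF : IsQuadraticFrobenius K q) {n m : Fin 3 → K}
    (hn : hermForm q n n = -1) (hm : hermForm q m m = -1) :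
    polarLine q n = polarLine q m ↔ ∃ z : K, z ^ (q + 1) = 1 ∧ m = z • n := by
  constructor
  · intro h
    obtain ⟨u, w, hf⟩ := hF.exists_frame_of_norm hn
    have hum := (span_mem_polarLine_iff hf.u_ne_zero hf.uu).2 hf.un
    have hwm := (span_mem_polarLine_iff (hf.symm hF).u_ne_zero hf.ww).2 hf.wn
    rw [h, span_mem_polarLine_iff hf.u_ne_zero hf.uu] at hum
    rw [h, span_mem_polarLine_iff (hf.symm hF).u_ne_zero hf.ww] at hwm
    obtain ⟨a, rfl⟩ := hf.eq_smul hF (hF.hermForm_eq_zero_comm hum)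
      (hF.hermForm_eq_zero_comm hwm)
    refine ⟨a, ?_, rfl⟩
    rw [hermForm_smul_left, hermForm_smul_right, hn] at hm
    rw [pow_succ]
    linear_combination -hm
  · rintro ⟨z, hz, rfl⟩
    rw [polarLine_smul]
    rintro rfl
    simp at hz

/-- The vector of the linear form det(·, u, w) is orthogonal to u and w, which span n^⊥, so it is a
multiple of n. The multiple is nonzero because its norm is -N(β(u,w)). -/
theorem detLine_eq_polarLine (hF : IsQuadraticFrobenius K q) {n u w : Fin 3 → K}
    (hn : hermForm q n n = -1) (huu : hermForm q u u = 0) (hun : hermForm q u n = 0)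
    (hwn : hermForm q w n = 0) (huw : hermForm q u w ≠ 0) :
    detLine q u w = polarLine q n := by
  have hu : u ≠ 0 := by
    rintro rfl
    exact huw (hermForm_zero_left w)
  obtain ⟨b, hf⟩ := hF.exists_frame hn hu huu hun
  obtain ⟨s, t, hst⟩ := hf.exists_of_orthogonal hF hwn
  have ht : t ≠ 0 := by
    rintro rfl
    apply huw
    rw [hst, hF.hermForm_add_right, hermForm_smul_right, hermForm_smul_right, huu,
      hF.zero_pow]
    ring
  have hmu := hF.hermForm_eq_zero_comm (hF.hermForm_left_detPolar u w)
  have hmw := hF.hermForm_eq_zero_comm (hF.hermForm_right_detPolar u w)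
  have hmb : hermForm q (detPolar q u w) b = 0 := by
    nth_rewrite 2 [hst] at hmw
    rw [hF.hermForm_add_right, hermForm_smul_right, hermForm_smul_right, hmu, mul_zero,
      zero_add] at hmw
    exact (mul_eq_zero.1 hmw).resolve_left (pow_ne_zero _ ht)
  obtain ⟨a, ha⟩ := hf.eq_smul hF hmu hmb
  have hmm := hF.hermForm_detPolar u w
  rw [huu, zero_mul, zero_sub, hF.hermForm_comm u w] at hmm
  have ha0 : a ≠ 0 := by
    rintro rfl
    rw [ha, zero_smul, hermForm_zero_left] at hmm
    exact neg_ne_zero.2 (mul_ne_zero huw (pow_ne_zero _ huw)) hmm.symm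
  rw [← polarLine_smul ha0, ← ha]
  unfold detLine polarLine
  ext P
  simp only [hF.det_eq_hermForm_detPolar]

end IsQuadraticFrobenius

end HermitianForm

/-! ### Flags and adjacency in terms of vectors -/

section Adjacency

variable {K : Type*} [Field K] {q : ℕ}

/-- The flag `f` consists of the point spanned by the isotropic vector `u` and the polar line of
the vector `n` of norm `-1`. -/
structure IsFlagRep (q : ℕ) (f : unitalFlags K q) (u n : Fin 3 → K) : Prop where
  nn : hermForm q n n = -1
  u_ne_zero : u ≠ 0
  uu : hermForm q u u = 0
  un : hermForm q u n = 0
  point : f.1.1 = Submodule.span K {u}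
  line : f.1.2 = polarLine q n

theorem exists_isFlagRep_of_line (f : unitalFlags K q)
    {n : Fin 3 → K} (hn : hermForm q n n = -1) (h : f.1.2 = polarLine q n) :
    ∃ u, IsFlagRep q f u n := by
  obtain ⟨⟨u, hu, huu, hP⟩, -, hi⟩ := f.2
  rw [hP, h, span_mem_polarLine_iff hu huu] at hi
  exact ⟨u, hn, hu, huu, hi, hP, h⟩

namespace IsQuadraticFrobenius

theorem exists_flag (hF : IsQuadraticFrobenius K q) {u n : Fin 3 → K}
    (hn : hermForm q n n = -1) (hu : u ≠ 0) (huu : hermForm q u u = 0)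
    (hun : hermForm q u n = 0) : ∃ f : unitalFlags K q, IsFlagRep q f u n :=
  ⟨⟨(Submodule.span K {u}, polarLine q n), span_mem_absolutePoints hu huu,
    hF.polarLine_mem_unitalLines hn, (span_mem_polarLine_iff hu huu).2 hun⟩,
    hn, hu, huu, hun, rfl, rfl⟩

theorem exists_isFlagRep (hF : IsQuadraticFrobenius K q) (f : unitalFlags K q) :
    ∃ u n, IsFlagRep q f u n := by
  obtain ⟨n, hn, hL⟩ := hF.exists_eq_polarLine f.2.2.1
  obtain ⟨u, h⟩ := exists_isFlagRep_of_line f hn hL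
  exact ⟨u, n, h⟩

end IsQuadraticFrobenius

/-- The exponents q p^(ir) in the adjacency relation run through the orbit of λ^q, which is the
orbit of λ by the hypothesis on λ. -/
theorem mem_frobGroup_orbit_iff (p e r : ℕ) {K : Type*} [Fact p.Prime] [Field K] [Finite K]
    [CharP K p] (hq : 2 < p ^ e) (hK : Nat.card K = (p ^ e) ^ 2) (hr : r ∣ 2 * e) {lam : K}
    (hlam : lam ^ p ^ e ∈ MulAction.orbit (frobGroup p r K) lam) (x : K) :
    x ∈ MulAction.orbit (frobGroup p r K) lam ↔
      ∃ i < 2 * e / r, x = lam ^ (p ^ e * p ^ (i * r)) := by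
  constructor
  · rintro ⟨⟨g, hg⟩, rfl⟩
    have : Finite (RingAut K) := Finite.of_injective (fun f : RingAut K => (f : K → K))
      DFunLike.coe_injective
    obtain ⟨t, rfl⟩ := (mem_powers_iff_mem_zpowers (x := frob p K ^ r)).2 hg
    obtain ⟨j, hj, h⟩ := exists_pow_eq p e r hq hK hr hlam t
    refine ⟨j, hj, ?_⟩
    rw [← h, mul_comm t r, ← frob_pow_apply, pow_mul]
    rfl
  · rintro ⟨i, -, rfl⟩
    have : lam ^ (p ^ e * p ^ (i * r)) =
        (⟨(frob p K ^ r) ^ i, Subgroup.npow_mem_zpowers _ i⟩ : frobGroup p r K) • lam ^ p ^ e := by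
      rw [pow_mul, mul_comm i r, ← frob_pow_apply, pow_mul (frob p K)]
      rfl
    rw [this]
    exact MulAction.mem_orbit_of_mem_orbit _ hlam

theorem ne_zero_of_mem_frobGroup_orbit {p r : ℕ} {K : Type*} [Fact p.Prime] [Field K] [Finite K]
    [CharP K p] {lam x : K} (h0 : lam ≠ 0) (h : x ∈ MulAction.orbit (frobGroup p r K) lam) :
    x ≠ 0 := by
  obtain ⟨g, rfl⟩ := h
  change (g : RingAut K) lam ≠ 0
  exact (map_ne_zero_iff _ (RingEquiv.injective _)).2 h0

/-- The two determinant lines are the polars of u₀ + u₁ and u₀ + c u₂ with μ c^q = 1. Up to norm-one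
scalars these vectors are n and m, and subtracting them eliminates u₀, leaving a relation between
the chosen representatives only. -/
theorem unitaryAdj_iff (p e r : ℕ) {K : Type*} [Fact p.Prime] [Field K] [Finite K]
    [CharP K p] (hq : 2 < p ^ e) (hK : Nat.card K = (p ^ e) ^ 2) (hr : r ∣ 2 * e) {lam : K}
    (h0 : lam ≠ 0) (hlam : lam ^ p ^ e ∈ MulAction.orbit (frobGroup p r K) lam)
    {f g : unitalFlags K (p ^ e)} {u n v m : Fin 3 → K} (hf : IsFlagRep (p ^ e) f u n)
    (hg : IsFlagRep (p ^ e) g v m) :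
    unitaryAdj p e r lam f g ↔ ∃ x y z : K, z ^ (p ^ e + 1) = 1 ∧ x • u - y • v = n - z • m ∧
      ∃ μ ∈ MulAction.orbit (frobGroup p r K) lam,
        hermForm (p ^ e) (x • u) (y • v) = μ⁻¹ := by
  have hF := isQuadraticFrobenius_of_card (p := p) (e := e) hq hK
  simp only [mem_frobGroup_orbit_iff p e r hq hK hr hlam]
  simp only [unitaryAdj]
  simp only [hf.point, hg.point, hf.line, hg.line]
  generalize p ^ e = q at *
  constructor
  · rintro ⟨u₀, u₁, u₂, i, hi, hp1, hp2, h12, h00, h01, h02, hL1, hL2⟩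
    set μ := lam ^ (q * p ^ (i * r)) with hμ
    have hμ0 : μ ≠ 0 := pow_ne_zero _ h0
    have hu1 : u₁ ≠ 0 := by
      rintro rfl
      rw [hermForm_zero_left] at h12
      exact zero_ne_one h12
    have h21 : hermForm q u₂ u₁ = 1 := by rw [hF.hermForm_comm, h12, one_pow]
    have hu2 : u₂ ≠ 0 := by
      rintro rfl
      rw [hermForm_zero_left] at h21
      exact zero_ne_one h21
    obtain ⟨a, ha, rfl⟩ := (span_eq_span_iff_exists_smul hu1).1 hp1
    obtain ⟨b, hb, rfl⟩ := (span_eq_span_iff_exists_smul hu2).1 hp2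
    have h11 : hermForm q (a • u) (a • u) = 0 := by rw [hermForm_smul_smul, hf.uu, mul_zero]
    have h22 : hermForm q (b • v) (b • v) = 0 := by rw [hermForm_smul_smul, hg.uu, mul_zero]
    have h10 := hF.hermForm_eq_zero_comm h01
    have h20 := hF.hermForm_eq_zero_comm h02
    set u₁ := a • u with hu₁
    set u₂ := b • v with hu₂
    -- Chosen so that β(u₀ + μu₁, u₀ + cu₂) = -1 + μc^q = 0.
    set c := (μ⁻¹) ^ q with hc
    have hcq : c ^ q = μ⁻¹ := hF.pow_pow _
    have hn1 : hermForm q (u₀ + u₁) (u₀ + u₁) = -1 := by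
      rw [hermForm_add_left, hF.hermForm_add_right, hF.hermForm_add_right, h00, h01, h10, h11]
      ring
    have hn2 : hermForm q (u₀ + c • u₂) (u₀ + c • u₂) = -1 := by
      simp only [hermForm_add_left, hF.hermForm_add_right, hermForm_smul_left,
        hermForm_smul_right, h00, h02, h20, h22]
      ring
    rw [hF.detLine_eq_polarLine hn1 h11 (by rw [hF.hermForm_add_right, h10, h11, add_zero])
      (by simp only [hermForm_add_left, hF.hermForm_add_right, h00, h01, h20, h21]; ring)
      (by rw [hF.hermForm_add_right, h10, h12, zero_add]; exact one_ne_zero),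
      hF.polarLine_eq_iff hf.nn hn1] at hL1
    rw [hF.detLine_eq_polarLine hn2 h22
      (by rw [hF.hermForm_add_right, hermForm_smul_right, h20, h22, mul_zero, add_zero])
      (by
        simp only [hermForm_add_left, hF.hermForm_add_right, hermForm_smul_left,
          hermForm_smul_right, h00, h02, h10, h12, hcq, mul_zero, add_zero, zero_add, mul_one]
        rw [inv_mul_cancel₀ hμ0, neg_add_cancel])
      (by
        rw [hF.hermForm_add_right, hermForm_smul_right, h20, h21, zero_add, mul_one]
        exact pow_ne_zero _ hμ0),
      hF.polarLine_eq_iff hg.nn hn2] at hL2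
    obtain ⟨s, hs, hs'⟩ := hL1
    obtain ⟨t, ht, ht'⟩ := hL2
    have hs0 : s ≠ 0 := by
      rintro rfl
      simp at hs
    have hsi : s⁻¹ * s⁻¹ ^ q = 1 := by
      rw [← pow_succ', inv_pow, hs, inv_one]
    -- Everything is scaled by s⁻¹ so that u₀ + u₁ becomes n itself; since s has norm one, values of
    -- the form do not change.
    refine ⟨s⁻¹ * a, s⁻¹ * (c * b), s⁻¹ * t, ?_, ?_, μ, ⟨i, hi, rfl⟩, ?_⟩
    · rw [mul_pow, ht, inv_pow, hs, inv_one, mul_one]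
    · have e1 : n = s⁻¹ • (u₀ + u₁) := by rw [hs', smul_smul, inv_mul_cancel₀ hs0, one_smul]
      rw [e1, mul_smul, mul_smul, mul_smul, mul_smul, ← ht', ← hu₁, ← hu₂, ← smul_sub, ← smul_sub]
      congr 1
      abel
    · rw [mul_smul, mul_smul, mul_smul, ← hu₁, ← hu₂, hermForm_smul_smul, hsi,
        hermForm_smul_right, h12, hcq]
      ring
  · rintro ⟨x, y, z, hz, heq, μ, ⟨i, hi, hμ⟩, hxy⟩
    have hμ0 : μ ≠ 0 := hμ ▸ pow_ne_zero _ h0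
    have hμq : μ ^ q ≠ 0 := pow_ne_zero _ hμ0
    have hx0 : x ≠ 0 := by
      rintro rfl
      rw [zero_smul, hermForm_zero_left] at hxy
      exact inv_ne_zero hμ0 hxy.symm
    have hy0 : y ≠ 0 := by
      rintro rfl
      rw [hermForm_smul_right, hF.zero_pow, zero_mul] at hxy
      exact inv_ne_zero hμ0 hxy.symm
    have h11 : hermForm q (x • u) (x • u) = 0 := by rw [hermForm_smul_smul, hf.uu, mul_zero]
    have h22 : hermForm q (y • v) (y • v) = 0 := by rw [hermForm_smul_smul, hg.uu, mul_zero]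
    have h1n : hermForm q (x • u) n = 0 := by rw [hermForm_smul_left, hf.un, mul_zero]
    have h2m : hermForm q (y • v) (z • m) = 0 := by
      rw [hermForm_smul_smul, hg.un, mul_zero]
    have hmm : hermForm q (z • m) (z • m) = -1 := by rw [hermForm_smul_self hz, hg.nn]
    have hz0 : z ≠ 0 := by
      rintro rfl
      simp at hz
    have hpx : Submodule.span K {x • u} = Submodule.span K {u} :=
      Submodule.span_singleton_smul_eq (IsUnit.mk0 x hx0) u
    have hpy : Submodule.span K {y • v} = Submodule.span K {v} :=
      Submodule.span_singleton_smul_eq (IsUnit.mk0 y hy0) v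
    have hLm := polarLine_smul (q := q) hz0 m
    rw [← hpx, ← hpy, ← hLm]
    have hn1 := hF.hermForm_eq_zero_comm h1n
    have hm2 := hF.hermForm_eq_zero_comm h2m
    have hnn := hf.nn
    generalize x • u = u₁ at *
    generalize y • v = v₁ at *
    generalize z • m = m₁ at *
    -- The relation says that n - u₁ and m₁ - v₁ coincide; this common vector is u₀, and it is
    -- orthogonal to both u₁ and v₁.
    obtain ⟨u₀, rfl⟩ : ∃ u₀, n = u₀ + u₁ := ⟨n - u₁, by abel⟩
    obtain rfl : m₁ = u₀ + v₁ := by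
      have : m₁ = u₀ + u₁ - (u₁ - v₁) := by rw [heq]; abel
      rw [this]; abel
    have h10 : hermForm q u₁ u₀ = 0 := by
      rwa [hF.hermForm_add_right, h11, add_zero] at h1n
    have h20 : hermForm q v₁ u₀ = 0 := by
      rwa [hF.hermForm_add_right, h22, add_zero] at h2m
    have h01 := hF.hermForm_eq_zero_comm h10
    have h02 := hF.hermForm_eq_zero_comm h20
    have h00 : hermForm q u₀ u₀ = -1 := by
      rwa [hermForm_add_left, hF.hermForm_add_right, hF.hermForm_add_right, h01, h10, h11,
        add_zero, add_zero, add_zero] at hnn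
    have h21 : hermForm q v₁ u₁ = (μ⁻¹) ^ q := by rw [hF.hermForm_comm, hxy]
    -- The factor μ^q restores the normalization β(u₁,u₂) = 1 required in the definition.
    have hyx : hermForm q u₁ (μ ^ q • v₁) = 1 := by
      rw [hermForm_smul_right, hxy, hF.pow_pow, mul_inv_cancel₀ hμ0]
    refine ⟨u₀, u₁, μ ^ q • v₁, i, hi, rfl, ?_, hyx, h00, h01, ?_, ?_, ?_⟩
    · exact (Submodule.span_singleton_smul_eq (IsUnit.mk0 _ hμq) v₁).symm
    · rw [hermForm_smul_right, h02, mul_zero]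
    · refine (hF.detLine_eq_polarLine hnn h11 h1n ?_ ?_).symm
      · simp only [hermForm_add_left, hF.hermForm_add_right, hermForm_smul_left, h00, h01, h20,
          h21, inv_pow]
        rw [mul_inv_cancel₀ hμq]
        ring
      · rw [hF.hermForm_add_right, h10, hyx, zero_add]
        exact one_ne_zero
    · rw [← hμ, detLine_smul _ _ _ hμq]
      refine (hF.detLine_eq_polarLine hmm h22 h2m ?_ ?_).symm
      · simp only [hermForm_add_left, hF.hermForm_add_right, hermForm_smul_left, h00, h02, h10,
          hxy, zero_add]
        rw [mul_inv_cancel₀ hμ0]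
        ring
      · rw [hF.hermForm_add_right, hermForm_smul_right, h20, h21, zero_add]
        exact mul_ne_zero hμq (pow_ne_zero _ (inv_ne_zero hμ0))

end Adjacency

/-! ### Neighbours of a flag on a given line -/

section Neighbours

variable {K : Type*} [Field K] {q : ℕ}

/-- `Γ` is the graph on flags whose adjacency is governed by the set `O` of parameters. -/
structure IsUnitaryGraph (q : ℕ) (O : Set K) (Γ : SimpleGraph (unitalFlags K q)) : Prop where
  zero_notMem : (0 : K) ∉ O
  adj_iff : ∀ {f g : unitalFlags K q} {u n v m : Fin 3 → K}, IsFlagRep q f u n →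
    IsFlagRep q g v m → (Γ.Adj f g ↔ ∃ x y z : K, z ^ (q + 1) = 1 ∧ x • u - y • v = n - z • m ∧
      ∃ μ ∈ O, hermForm q (x • u) (y • v) = μ⁻¹)

/-- The norms of the elements `μ⁻¹ - 1` with `μ ∈ O`. -/
def normSet (q : ℕ) (O : Set K) : Set K := (fun μ => (μ⁻¹ - 1) ^ (q + 1)) '' O

/-- The elements `z` of norm one for which `z ^ q * h` has the form `μ⁻¹ - 1` with `μ ∈ O`. -/
def connectors (q : ℕ) (O : Set K) (h : K) : Set K :=
  {z | z ^ (q + 1) = 1 ∧ ∃ μ ∈ O, z ^ q * h = μ⁻¹ - 1}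

/-- A norm-one factor carries h to μ⁻¹ - 1 exactly when the two have equal norms. For h ≠ 0 the
factor is their quotient; for h = 0 every norm-one factor works. -/
theorem IsQuadraticFrobenius.connectors_nonempty_iff (hF : IsQuadraticFrobenius K q) (O : Set K)
    (h : K) : (connectors q O h).Nonempty ↔ h ^ (q + 1) ∈ normSet q O := by
  constructor
  · rintro ⟨z, hz, μ, hμ, heq⟩
    refine ⟨μ, hμ, ?_⟩
    change (μ⁻¹ - 1) ^ (q + 1) = _
    rw [← heq, mul_pow, hF.pow_pow_succ, hz, one_mul]
  · rintro ⟨μ, hμ, heq⟩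
    change (μ⁻¹ - 1) ^ (q + 1) = _ at heq
    by_cases h0 : h = 0
    · subst h0
      rw [_root_.zero_pow (Nat.succ_ne_zero q)] at heq
      exact ⟨1, one_pow _, μ, hμ, by rw [mul_zero, eq_zero_of_pow_eq_zero heq]⟩
    · refine ⟨((μ⁻¹ - 1) / h) ^ q, ?_, μ, hμ, ?_⟩
      · rw [hF.pow_pow_succ, div_pow, heq, div_self (pow_ne_zero _ h0)]
      · rw [hF.pow_pow, div_mul_cancel₀ _ h0]

/-- Nonzero values are connected by as many elements as there are parameters of the same norm. -/
theorem IsQuadraticFrobenius.ncard_connectors (hF : IsQuadraticFrobenius K q) (O : Set K) {h : K} (h0 : h ≠ 0) :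
    (connectors q O h).ncard = {μ | μ ∈ O ∧ (μ⁻¹ - 1) ^ (q + 1) = h ^ (q + 1)}.ncard := by
  -- The parameter is determined by z as μ = (1 + z^q h)⁻¹. Because 0⁻¹ = 0, no separate treatment
  -- of 1 + z^q h = 0 is needed.
  have key : ∀ z : K, (∃ μ ∈ O, z ^ q * h = μ⁻¹ - 1) ↔ (1 + z ^ q * h)⁻¹ ∈ O := by
    intro z
    constructor
    · rintro ⟨μ, hμ, heq⟩
      rwa [heq, add_sub_cancel, inv_inv]
    · intro hz
      exact ⟨_, hz, by rw [inv_inv, add_sub_cancel_left]⟩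
  refine Set.ncard_congr (fun z _ => (1 + z ^ q * h)⁻¹) ?_ ?_ ?_
  · rintro z ⟨hz, hex⟩
    refine ⟨(key z).1 hex, ?_⟩
    rw [inv_inv, add_sub_cancel_left, mul_pow, hF.pow_pow_succ, hz, one_mul]
  · intro z z' _ _ heq
    have := mul_right_cancel₀ h0 (add_left_cancel (inv_injective heq))
    rw [← hF.pow_pow z, this, hF.pow_pow]
  · rintro μ ⟨hμ, heq⟩
    have e : (((μ⁻¹ - 1) / h) ^ q) ^ q * h = μ⁻¹ - 1 := by
      rw [hF.pow_pow, div_mul_cancel₀ _ h0]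
    refine ⟨((μ⁻¹ - 1) / h) ^ q, ⟨?_, μ, hμ, e⟩, ?_⟩
    · rw [hF.pow_pow_succ, div_pow, heq, div_self (pow_ne_zero _ h0)]
    · rw [e, add_sub_cancel, inv_inv]

theorem connectors_zero : connectors q {(1 : K)} 0 = {z | z ^ (q + 1) = 1} := by
  ext z
  simp [connectors]

namespace IsUnitaryGraph

variable {O : Set K} {Γ : SimpleGraph (unitalFlags K q)}

/-- Expanding β(xu, yv) with yv = xu - n + zm gives x z^q β(u,m) = μ⁻¹, hence β(u,m) ≠ 0. Then β(yv,
zm) = 0 gives z^q β(n,m) = μ⁻¹ - 1, and so x is a function of z. -/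
theorem adj_data (hF : IsQuadraticFrobenius K q) (hΓ : IsUnitaryGraph q O Γ)
    {f g : unitalFlags K q} {u n v m : Fin 3 → K} (hf : IsFlagRep q f u n)
    (hg : IsFlagRep q g v m) (h : Γ.Adj f g) :
    hermForm q u m ≠ 0 ∧ ∃ z y : K, z ∈ connectors q O (hermForm q n m) ∧ y ≠ 0 ∧
      y • v = ((1 + z ^ q * hermForm q n m) / (z ^ q * hermForm q u m)) • u - n + z • m := by
  obtain ⟨x, y, z, hz, heq, μ, hμ, hxy⟩ := (hΓ.adj_iff hf hg).1 h
  have hμ0 : μ⁻¹ ≠ 0 := inv_ne_zero (fun h => hΓ.zero_notMem (h ▸ hμ))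
  have hz0 : z ^ q ≠ 0 := by
    rintro h
    rw [pow_succ, h, zero_mul] at hz
    exact zero_ne_one hz
  have hyv : y • v = x • u - n + z • m := by
    have : y • v = x • u - (x • u - y • v) := by abel
    rw [this, heq]
    abel
  have e1 : x * z ^ q * hermForm q u m = μ⁻¹ := by
    rw [← hxy, hyv]
    simp only [hF.hermForm_add_right, hF.hermForm_sub_right, hermForm_smul_left,
      hermForm_smul_right, hf.uu, hf.un]
    ring
  have hum : hermForm q u m ≠ 0 := by
    intro h
    rw [h, mul_zero] at e1
    exact hμ0 e1.symm
  have e2 : z ^ q * hermForm q n m = μ⁻¹ - 1 := by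
    have h1 : hermForm q (y • v) (z • m) = 0 := by rw [hermForm_smul_smul, hg.un, mul_zero]
    rw [hyv] at h1
    simp only [hermForm_add_left, hermForm_sub_left, hermForm_smul_left, hermForm_smul_right,
      hg.nn] at h1
    have hz' := IsQuadraticFrobenius.mul_pow_of_norm_eq_one hz
    linear_combination (-1 : K) * h1 + e1 - hz'
  refine ⟨hum, z, y, ⟨hz, μ, hμ, e2⟩, ?_, ?_⟩
  · rintro rfl
    rw [hermForm_smul_right, hF.zero_pow, zero_mul] at hxy
    exact hμ0 hxy.symm
  · rw [hyv, e2]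
    congr 3
    rw [eq_div_iff (mul_ne_zero hz0 hum)]
    linear_combination e1

/-- The flags on a line adjacent to a given flag. -/
theorem ncard_neighbours (hF : IsQuadraticFrobenius K q) (hΓ : IsUnitaryGraph q O Γ)
    {f : unitalFlags K q} {u n m : Fin 3 → K} (hf : IsFlagRep q f u n)
    (hm : hermForm q m m = -1) (hum : hermForm q u m ≠ 0) :
    (flagsOnLine q (polarLine q m) ∩ Γ.neighborSet f).ncard =
      (connectors q O (hermForm q n m)).ncard := by
  have hnu := hF.hermForm_eq_zero_comm hf.un
  have hmu : hermForm q m u ≠ 0 := by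
    rw [hF.hermForm_comm]
    exact pow_ne_zero _ hum
  have hnm := hF.hermForm_comm n m
  have hmu' := hF.hermForm_comm u m
  -- The only possible representative of the neighbour's point, as dictated by `adj_data`.
  set F : K → Fin 3 → K := fun z =>
    ((1 + z ^ q * hermForm q n m) / (z ^ q * hermForm q u m)) • u - n + z • m with hFdef
  have hFu : ∀ z, hermForm q (F z) u = z * hermForm q m u := by
    intro z
    simp only [hFdef, hermForm_add_left, hermForm_sub_left, hermForm_smul_left, hf.uu, hnu]
    ring
  have hFn : ∀ z, hermForm q (F z) n = 1 + z * hermForm q m n := by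
    intro z
    simp only [hFdef, hermForm_add_left, hermForm_sub_left, hermForm_smul_left, hf.un, hf.nn]
    ring
  have prop : ∀ z ∈ connectors q O (hermForm q n m),
      F z ≠ 0 ∧ hermForm q (F z) m = 0 ∧ hermForm q (F z) (F z) = 0 ∧
      ∃ μ ∈ O, hermForm q (((1 + z ^ q * hermForm q n m) / (z ^ q * hermForm q u m)) • u) (F z)
        = μ⁻¹ := by
    rintro z ⟨hz, μ, hμ, heq⟩
    have hz0 : z ≠ 0 := by
      rintro rfl
      simp at hz
    have hzq : z ^ q ≠ 0 := pow_ne_zero _ hz0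
    have hz' := IsQuadraticFrobenius.mul_pow_of_norm_eq_one hz
    have hFm : hermForm q (F z) m = 0 := by
      simp only [hFdef, hermForm_add_left, hermForm_sub_left, hermForm_smul_left, hm]
      apply mul_left_cancel₀ hzq
      field_simp
      linear_combination -hz'
    have huF : hermForm q u (F z) = z ^ q * hermForm q u m := by
      rw [hF.hermForm_comm, hFu, mul_pow, ← hF.hermForm_comm]
    refine ⟨?_, hFm, ?_, μ, hμ, ?_⟩
    · intro h
      have := hFu z
      rw [h, hermForm_zero_left] at this
      exact mul_ne_zero hz0 hmu this.symm
    -- Only the second argument is expanded, so the known pairings of F z with u, n and m can be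
    -- inserted directly.
    · have : hermForm q (F z) (F z) =
          ((1 + z ^ q * hermForm q n m) / (z ^ q * hermForm q u m)) ^ q * hermForm q (F z) u -
            hermForm q (F z) n + z ^ q * hermForm q (F z) m := by
        conv_lhs => rw [hFdef]
        simp only [hF.hermForm_add_right, hF.hermForm_sub_right, hermForm_smul_right]
        rfl
      rw [this, hFm, hFu, hFn, hmu', hnm, div_pow, hF.add_pow, one_pow, mul_pow, hF.pow_pow,
        mul_pow, hF.pow_pow, div_mul_cancel₀]
      · ring
      · exact mul_ne_zero hz0 (pow_ne_zero _ hum)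
    · rw [hermForm_smul_left, huF, div_mul_cancel₀ _ (mul_ne_zero hzq hum), heq]
      ring
  have : Nonempty (unitalFlags K q) := ⟨f⟩
  choose! G hG using fun z (hz : z ∈ connectors q O (hermForm q n m)) =>
    hF.exists_flag hm (prop z hz).1 (prop z hz).2.2.1 (prop z hz).2.1
  symm
  refine Set.ncard_congr (fun z _ => G z) ?_ ?_ ?_
  · intro z hz
    refine ⟨(hG z hz).line, ?_⟩
    obtain ⟨-, -, -, μ, hμ, hh⟩ := prop z hz
    refine (hΓ.adj_iff hf (hG z hz)).2 ⟨(1 + z ^ q * hermForm q n m) / (z ^ q * hermForm q u m), 1, z,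
      hz.1, ?_, μ, hμ, by rw [one_smul K (F z)]; exact hh⟩
    rw [one_smul K (F z)]
    simp only [hFdef]
    rw [sub_add, sub_sub_cancel]
  · intro z z' hz hz' heq
    have h1 := (hG z hz).point
    rw [show G z = G z' from heq, (hG z' hz').point,
      span_eq_span_iff_exists_smul (prop z hz).1] at h1
    obtain ⟨a, ha, haF⟩ := h1
    have e1 := hFu z
    have e2 := hFn z
    rw [haF, hermForm_smul_left, hFu] at e1
    rw [haF, hermForm_smul_left, hFn] at e2
    have e3 : a * z' = z := by
      apply mul_right_cancel₀ hmu
      rw [← e1]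
      ring
    -- The pairings with u and n give az' = z and a(1 + z'β(m,n)) = 1 + zβ(m,n); the terms with
    -- β(m,n) cancel.
    have e4 : a = 1 := by
      linear_combination e2 - hermForm q m n * e3
    rw [← e3, e4, one_mul]
  · rintro g ⟨hgl, hadj⟩
    obtain ⟨v, hg⟩ := exists_isFlagRep_of_line g hm hgl
    obtain ⟨-, z, y, hz, hy, hyv⟩ := hΓ.adj_data hF hf hg hadj
    refine ⟨z, hz, ?_⟩
    have : (G z).1 = g.1 := by
      refine Prod.ext ?_ ?_
      · rw [(hG z hz).point, hg.point, eq_comm, span_eq_span_iff_exists_smul (prop z hz).1]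
        exact ⟨y, hy, hyv.symm⟩
      · rw [(hG z hz).line, hgl]
    exact Subtype.ext this

theorem neighbours_nonempty_iff (hF : IsQuadraticFrobenius K q) (hΓ : IsUnitaryGraph q O Γ)
    {f : unitalFlags K q} {u n m : Fin 3 → K} (hf : IsFlagRep q f u n)
    (hm : hermForm q m m = -1) :
    (flagsOnLine q (polarLine q m) ∩ Γ.neighborSet f).Nonempty ↔
      hermForm q u m ≠ 0 ∧ hermForm q n m ^ (q + 1) ∈ normSet q O := by
  have := hF.finite
  rw [← hF.connectors_nonempty_iff]
  constructor
  · rintro ⟨g, hgl, hadj⟩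
    obtain ⟨v, hg⟩ := exists_isFlagRep_of_line g hm hgl
    obtain ⟨hum, z, y, hz, -⟩ := hΓ.adj_data hF hf hg hadj
    exact ⟨hum, z, hz⟩
  · rintro ⟨hum, hne⟩
    apply Set.nonempty_of_ncard_ne_zero
    rw [hΓ.ncard_neighbours hF hf hm hum]
    exact (Set.ncard_pos).2 hne |>.ne'

end IsUnitaryGraph

end Neighbours

/-! ### Blocks of flags -/

section Blocks

variable {K : Type*} [Field K] {q : ℕ}

/-- The flags whose line is the polar of `m`. -/
def polarBlock (q : ℕ) (m : Fin 3 → K) : Set (unitalFlags K q) := flagsOnLine q (polarLine q m)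

theorem IsFlagRep.mem_polarBlock {f : unitalFlags K q} {u n : Fin 3 → K} (h : IsFlagRep q f u n) :
    f ∈ polarBlock q n := h.line

theorem IsFlagRep.eq {f g : unitalFlags K q} {u v n : Fin 3 → K} (hf : IsFlagRep q f u n)
    (hg : IsFlagRep q g v n) {a : K} (ha : a ≠ 0) (h : v = a • u) : f = g := by
  refine Subtype.ext (Prod.ext ?_ (hf.line.trans hg.line.symm))
  rw [hf.point, hg.point]
  exact (span_eq_span_iff_exists_smul hg.u_ne_zero).2 ⟨a, ha, h⟩

namespace IsQuadraticFrobenius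

theorem mem_linePartition_iff (hF : IsQuadraticFrobenius K q) (B : Set (unitalFlags K q)) :
    B ∈ linePartition K q ↔ ∃ m, hermForm q m m = -1 ∧ B = polarBlock q m := by
  constructor
  · rintro ⟨L, hL, rfl⟩
    obtain ⟨m, hm, rfl⟩ := hF.exists_eq_polarLine hL
    exact ⟨m, hm, rfl⟩
  · rintro ⟨m, hm, rfl⟩
    exact ⟨_, hF.polarLine_mem_unitalLines hm, rfl⟩

theorem polarBlock_nonempty (hF : IsQuadraticFrobenius K q) {n : Fin 3 → K}
    (hn : hermForm q n n = -1) : (polarBlock q n).Nonempty := by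
  obtain ⟨u, hu, huu, hun⟩ := hF.exists_isotropic hn
  obtain ⟨f, hf⟩ := hF.exists_flag hn hu huu hun
  exact ⟨f, hf.mem_polarBlock⟩

theorem polarBlock_eq_iff (hF : IsQuadraticFrobenius K q) {n m : Fin 3 → K}
    (hn : hermForm q n n = -1) (hm : hermForm q m m = -1) :
    polarBlock q n = polarBlock q m ↔ ∃ z : K, z ^ (q + 1) = 1 ∧ m = z • n := by
  rw [← hF.polarLine_eq_iff hn hm]
  constructor
  · intro h
    obtain ⟨f, hf⟩ := hF.polarBlock_nonempty hn
    have hf' : f ∈ polarBlock q m := h ▸ hf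
    exact Eq.trans (Eq.symm hf) hf'
  · intro h
    rw [polarBlock, polarBlock, h]

/-- In a frame n, u, w the absolute points of n^⊥ are ⟨u⟩ and the points ⟨tu + w⟩ with t + t^q = 0,
of which there are q. -/
theorem ncard_polarBlock (hF : IsQuadraticFrobenius K q) {n : Fin 3 → K}
    (hn : hermForm q n n = -1) : (polarBlock q n).ncard = q + 1 := by
  have := hF.finite
  obtain ⟨u, w, hfr⟩ := hF.exists_frame_of_norm hn
  obtain ⟨f₀, hf₀⟩ := hF.exists_flag hn hfr.u_ne_zero hfr.uu hfr.un
  have hwu := hfr.wu hF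
  set S : Set K := {t | t + t ^ q = 0} with hS
  have prop : ∀ t ∈ S, t • u + w ≠ 0 ∧ hermForm q (t • u + w) (t • u + w) = 0 ∧
      hermForm q (t • u + w) n = 0 := by
    intro t ht
    have ht' : t + t ^ q = 0 := ht
    refine ⟨fun h => ?_, ?_, ?_⟩
    · have := hermForm_zero_left (q := q) u
      rw [← h, hermForm_add_left, hermForm_smul_left, hfr.uu, hwu, mul_zero, zero_add] at this
      exact one_ne_zero this
    · simp only [hermForm_add_left, hF.hermForm_add_right, hermForm_smul_left,
        hermForm_smul_right, hfr.uu, hfr.uw, hwu, hfr.ww]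
      linear_combination ht'
    · rw [hermForm_add_left, hermForm_smul_left, hfr.un, hfr.wn, mul_zero, add_zero]
  have : Nonempty (unitalFlags K q) := ⟨f₀⟩
  choose! G hG using fun t (ht : t ∈ S) =>
    hF.exists_flag hn (prop t ht).1 (prop t ht).2.1 (prop t ht).2.2
  have hdec : polarBlock q n = insert f₀ (G '' S) := by
    ext g
    constructor
    · intro hg
      obtain ⟨v, hv⟩ := exists_isFlagRep_of_line g hn hg
      obtain ⟨a, b, hab⟩ := hfr.exists_of_orthogonal hF hv.un
      by_cases hb : b = 0
      · subst hb
        rw [zero_smul, add_zero] at hab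
        left
        refine (hf₀.eq hv (a := a) ?_ hab).symm
        rintro rfl
        exact hv.u_ne_zero (by rw [hab, zero_smul])
      · right
        have hvv := hv.uu
        simp only [hab, hermForm_add_left, hF.hermForm_add_right, hermForm_smul_left,
          hermForm_smul_right, hfr.uu, hfr.uw, hwu, hfr.ww] at hvv
        have hbq : b ^ q ≠ 0 := pow_ne_zero _ hb
        have hmem : a / b ∈ S := by
          change a / b + (a / b) ^ q = 0
          rw [div_pow]
          field_simp
          linear_combination hvv
        refine ⟨a / b, hmem, (hG _ hmem).eq hv hb ?_⟩
        rw [hab, smul_add, smul_smul, mul_div_cancel₀ _ hb]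
    · rintro (rfl | ⟨t, ht, rfl⟩)
      · exact hf₀.mem_polarBlock
      · exact (hG t ht).mem_polarBlock
  rw [hdec, Set.ncard_insert_of_notMem, Set.InjOn.ncard_image, hF.ncard_trace_eq hF.zero_pow]
  · intro t ht t' ht' heq
    have h1 := (hG t ht).point
    rw [show G t = G t' from heq, (hG t' ht').point,
      span_eq_span_iff_exists_smul (prop t ht).1] at h1
    obtain ⟨a, -, h⟩ := h1
    have e1 := congrArg (fun x => hermForm q x u) h
    have e2 := congrArg (fun x => hermForm q x w) h
    simp only [hermForm_add_left, hermForm_smul_left, hfr.uu, hfr.uw, hwu, hfr.ww] at e1 e2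
    linear_combination e2 - t' * e1
  · rintro ⟨t, ht, heq⟩
    have h1 := (hG t ht).point
    rw [heq, hf₀.point, span_eq_span_iff_exists_smul (prop t ht).1] at h1
    obtain ⟨a, -, h⟩ := h1
    have e1 := congrArg (fun x => hermForm q x u) h
    simp only [hermForm_add_left, hermForm_smul_left, hfr.uu, hwu, mul_zero, zero_add] at e1
    exact one_ne_zero e1

theorem isPartition_linePartition (hF : IsQuadraticFrobenius K q) :
    Setoid.IsPartition (linePartition K q) := by
  constructor
  · intro h
    obtain ⟨m, hm, he⟩ := (hF.mem_linePartition_iff _).1 h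
    exact (hF.polarBlock_nonempty hm).ne_empty he.symm
  · intro f
    refine ⟨flagsOnLine q f.1.2, ⟨⟨f.1.2, f.2.2.1, rfl⟩, rfl⟩, ?_⟩
    rintro _ ⟨⟨L, hL, rfl⟩, hfL⟩
    rw [show f.1.2 = L from hfL]

/-- Each line of the unital is the polar of exactly `q + 1` vectors of norm `-1`. -/
theorem ncard_image_polarBlock (hF : IsQuadraticFrobenius K q) {M : Set (Fin 3 → K)}
    (hM : ∀ m ∈ M, hermForm q m m = -1)
    (hz : ∀ m ∈ M, ∀ z : K, z ^ (q + 1) = 1 → z • m ∈ M) :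
    (polarBlock q '' M).ncard * (q + 1) = M.ncard := by
  have := hF.finite
  symm
  refine ncard_eq_mul_of_fibers (polarBlock q) (fun m hm => ⟨m, hm, rfl⟩) ?_
  rintro _ ⟨m, hm, rfl⟩
  have hm0 : m ≠ 0 := by
    rintro rfl
    have := hM 0 hm
    rw [hermForm_zero_left] at this
    exact neg_ne_zero.2 one_ne_zero this.symm
  have : {a | a ∈ M ∧ polarBlock q a = polarBlock q m} =
      (fun z : K => z • m) '' {z | z ^ (q + 1) = 1} := by
    ext a
    constructor
    · rintro ⟨ha, h⟩
      obtain ⟨z, hz, rfl⟩ := (hF.polarBlock_eq_iff (hM m hm) (hM a ha)).1 h.symm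
      exact ⟨z, hz, rfl⟩
    · rintro ⟨z, hz1, rfl⟩
      have hmem := hz m hm z hz1
      exact ⟨hmem, ((hF.polarBlock_eq_iff (hM m hm) (hM _ hmem)).2 ⟨z, hz1, rfl⟩).symm⟩
  rw [this, Set.ncard_image_of_injective _ (smul_left_injective K hm0), hF.ncard_norm_eq_one]

end IsQuadraticFrobenius

/-! ### Counting vectors of norm `-1` -/

namespace IsHyperbolicFrame

variable {n u w : Fin 3 → K}

theorem norm_hermForm_frameVector (hF : IsQuadraticFrobenius K q)
    (h : IsHyperbolicFrame q n u w) (c : K × K × K) :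
    hermForm q n (frameVector n u w c) ^ (q + 1) = c.1 ^ (q + 1) := by
  rw [hF.hermForm_comm, hF.pow_pow_succ, h.frameVector_left_n, hF.neg_pow_succ]

theorem hermForm_u_frameVector_eq_zero_iff (hF : IsQuadraticFrobenius K q)
    (h : IsHyperbolicFrame q n u w) (c : K × K × K) :
    hermForm q u (frameVector n u w c) = 0 ↔ c.2.2 = 0 := by
  rw [hF.hermForm_comm, h.frameVector_left_u hF, pow_eq_zero_iff hF.ne_zero]

theorem hermForm_w_frameVector_eq_zero_iff (hF : IsQuadraticFrobenius K q)
    (h : IsHyperbolicFrame q n u w) (c : K × K × K) :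
    hermForm q w (frameVector n u w c) = 0 ↔ c.2.1 = 0 := by
  rw [hF.hermForm_comm, h.frameVector_left_w hF, pow_eq_zero_iff hF.ne_zero]

theorem ncard_setOf (hF : IsQuadraticFrobenius K q) (h : IsHyperbolicFrame q n u w)
    (P : (Fin 3 → K) → Prop) : {m | P m}.ncard = {c | P (frameVector n u w c)}.ncard := by
  rw [← Set.ncard_image_of_injective _ (h.frameVector_injective hF)]
  congr 1
  exact (Set.image_preimage_eq {m | P m} (h.frameVector_surjective hF)).symm

/-- In frame coordinates (a, b, c) the value β(n,m) has norm N(a), and β(u,m) ≠ 0 means c ≠ 0. Each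
admissible a leaves the hyperbolic equation bc^q + cb^q = N(a) - 1. -/
theorem ncard_vectors_of_ne_zero (hF : IsQuadraticFrobenius K q)
    (h : IsHyperbolicFrame q n u w) (T : Set K) :
    {m | hermForm q m m = -1 ∧ hermForm q n m ^ (q + 1) ∈ T ∧ hermForm q u m ≠ 0}.ncard =
      {a : K | a ^ (q + 1) ∈ T}.ncard * ((q ^ 2 - 1) * q) := by
  have := hF.finite
  rw [h.ncard_setOf hF]
  simp only [h.norm_hermForm_frameVector hF, h.frameVector_self hF, ne_eq,
    h.hermForm_u_frameVector_eq_zero_iff hF]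
  refine ncard_eq_mul_of_fibers Prod.fst (fun c hc => hc.2.1) ?_
  intro a ha
  have hs : (a ^ (q + 1) - 1) ^ q = a ^ (q + 1) - 1 := by
    rw [hF.sub_pow, hF.pow_succ_pow, one_pow]
  refine Eq.trans ?_ (hF.ncard_hyperbolic hs)
  refine Set.ncard_congr (fun c _ => c.2) ?_ ?_ ?_
  · rintro c ⟨⟨h1, -, h2⟩, rfl⟩
    exact ⟨h2, by linear_combination h1⟩
  · rintro c d ⟨-, h1⟩ ⟨-, h2⟩ heq
    exact Prod.ext (h1.trans h2.symm) heq
  · rintro c ⟨h1, h2⟩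
    exact ⟨(a, c), ⟨⟨by linear_combination h2, ha, h1⟩, rfl⟩, rfl⟩

theorem ncard_vectors_of_eq_zero (hF : IsQuadraticFrobenius K q)
    (h : IsHyperbolicFrame q n u w) :
    {m | hermForm q m m = -1 ∧ hermForm q n m ^ (q + 1) = 1 ∧ hermForm q u m = 0 ∧
      hermForm q w m ≠ 0}.ncard = (q + 1) * (q ^ 2 - 1) := by
  have := hF.finite
  rw [h.ncard_setOf hF]
  simp only [h.norm_hermForm_frameVector hF, h.frameVector_self hF, ne_eq,
    h.hermForm_u_frameVector_eq_zero_iff hF, h.hermForm_w_frameVector_eq_zero_iff hF]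
  refine Eq.trans (ncard_eq_mul_of_fibers (t := {a : K | a ^ (q + 1) = 1}) (n := q ^ 2 - 1)
    Prod.fst (fun c hc => hc.2.1) ?_) (by rw [hF.ncard_norm_eq_one])
  intro a ha
  have ha' : a ^ (q + 1) = 1 := ha
  refine Eq.trans ?_ hF.ncard_ne_zero
  refine Set.ncard_congr (fun c _ => c.2.1) ?_ ?_ ?_
  · rintro c ⟨⟨-, -, -, h2⟩, rfl⟩
    exact h2
  · rintro c d ⟨⟨-, -, h3, -⟩, h1⟩ ⟨⟨-, -, h4, -⟩, h2⟩ heq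
    exact Prod.ext (h1.trans h2.symm) (Prod.ext heq (h3.trans h4.symm))
  · intro x hx
    refine ⟨(a, x, 0), ⟨⟨?_, ha', rfl, hx⟩, rfl⟩, rfl⟩
    change -a ^ (q + 1) + (x * 0 ^ q + 0 * x ^ q) = -1
    rw [ha', hF.zero_pow]
    ring

end IsHyperbolicFrame

/-- Orthogonality to u removes the w-coordinate of m, so the norm of m is just -N(a). Thus only the
value 1 in `normSet` can produce flags without neighbours in an adjacent block. -/
theorem IsQuadraticFrobenius.norm_eq_one_of_orthogonal (hF : IsQuadraticFrobenius K q)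
    {n u m : Fin 3 → K} (hn : hermForm q n n = -1) (hu : u ≠ 0) (huu : hermForm q u u = 0)
    (hun : hermForm q u n = 0) (hm : hermForm q m m = -1) (hum : hermForm q u m = 0) :
    hermForm q n m ^ (q + 1) = 1 := by
  obtain ⟨w, h⟩ := hF.exists_frame hn hu huu hun
  obtain ⟨c, rfl⟩ := h.frameVector_surjective hF m
  rw [h.hermForm_u_frameVector_eq_zero_iff hF] at hum
  rw [h.frameVector_self hF, hum, hF.zero_pow] at hm
  rw [h.norm_hermForm_frameVector hF]
  linear_combination -hm

/-! ### The quotient graph -/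

namespace IsUnitaryGraph

variable {O : Set K} {Γ : SimpleGraph (unitalFlags K q)}

theorem not_adj_of_mem_polarBlock (hF : IsQuadraticFrobenius K q) (hΓ : IsUnitaryGraph q O Γ)
    {n : Fin 3 → K} (hn : hermForm q n n = -1) {f g : unitalFlags K q} (hf : f ∈ polarBlock q n)
    (hg : g ∈ polarBlock q n) : ¬ Γ.Adj f g := by
  intro h
  obtain ⟨u, hu⟩ := exists_isFlagRep_of_line f hn hf
  exact ((hΓ.neighbours_nonempty_iff hF hu hn).1 ⟨g, hg, h⟩).1 hu.un

/-- The existence of u ensures that the two lines differ, which the norm condition alone does not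
guarantee when 1 belongs to `normSet`. -/
theorem quotient_adj_iff (hF : IsQuadraticFrobenius K q) (hΓ : IsUnitaryGraph q O Γ)
    {n m : Fin 3 → K} (hn : hermForm q n n = -1) (hm : hermForm q m m = -1)
    {B D : linePartition K q} (hB : B.1 = polarBlock q n) (hD : D.1 = polarBlock q m) :
    (quotientGraph Γ (linePartition K q)).Adj B D ↔
      hermForm q n m ^ (q + 1) ∈ normSet q O ∧
        ∃ u, u ≠ 0 ∧ hermForm q u u = 0 ∧ hermForm q u n = 0 ∧ hermForm q u m ≠ 0 := by
  constructor
  · rintro ⟨-, f, hf, g, hg, h⟩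
    rw [hB] at hf
    rw [hD] at hg
    obtain ⟨u, hu⟩ := exists_isFlagRep_of_line f hn hf
    obtain ⟨h1, h2⟩ := (hΓ.neighbours_nonempty_iff hF hu hm).1 ⟨g, hg, h⟩
    exact ⟨h2, u, hu.u_ne_zero, hu.uu, hu.un, h1⟩
  · rintro ⟨hT, u, hu, huu, hun, hum⟩
    obtain ⟨f, hf⟩ := hF.exists_flag hn hu huu hun
    obtain ⟨g, hg, hfg⟩ := (hΓ.neighbours_nonempty_iff hF hf hm).2 ⟨hum, hT⟩
    have hgD : g ∈ polarBlock q m := hg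
    refine ⟨?_, f, hB ▸ hf.mem_polarBlock, g, hD ▸ hgD, hfg⟩
    rintro rfl
    refine hΓ.not_adj_of_mem_polarBlock hF hn hf.mem_polarBlock ?_ hfg
    rw [← hB, hD]
    exact hgD

theorem ncard_blocks_of_vertex (hF : IsQuadraticFrobenius K q) (hΓ : IsUnitaryGraph q O Γ)
    (f : unitalFlags K q) :
    {B ∈ linePartition K q | (B ∩ Γ.neighborSet f).Nonempty}.ncard * (q + 1) =
      {a : K | a ^ (q + 1) ∈ normSet q O}.ncard * ((q ^ 2 - 1) * q) := by
  obtain ⟨u, n, hf⟩ := hF.exists_isFlagRep f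
  obtain ⟨w, h⟩ := hF.exists_frame hf.nn hf.u_ne_zero hf.uu hf.un
  rw [← h.ncard_vectors_of_ne_zero hF, ← hF.ncard_image_polarBlock]
  · congr 2
    ext B
    constructor
    · rintro ⟨hB, hne⟩
      obtain ⟨m, hm, rfl⟩ := (hF.mem_linePartition_iff B).1 hB
      obtain ⟨h1, h2⟩ := (hΓ.neighbours_nonempty_iff hF hf hm).1 hne
      exact ⟨m, ⟨hm, h2, h1⟩, rfl⟩
    · rintro ⟨m, ⟨hm, h2, h1⟩, rfl⟩
      exact ⟨(hF.mem_linePartition_iff _).2 ⟨m, hm, rfl⟩,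
        (hΓ.neighbours_nonempty_iff hF hf hm).2 ⟨h1, h2⟩⟩
  · rintro m ⟨hm, -⟩
    exact hm
  · rintro m ⟨hm, h2, h1⟩ z hz
    refine ⟨by rw [hermForm_smul_self hz, hm], ?_, ?_⟩
    · rwa [hermForm_smul_right, mul_pow, hF.pow_pow_succ, hz, one_mul]
    · rw [hermForm_smul_right]
      refine mul_ne_zero (pow_ne_zero _ ?_) h1
      rintro rfl
      simp at hz

theorem ncard_quotient_neighborSet (hF : IsQuadraticFrobenius K q) (hΓ : IsUnitaryGraph q O Γ)
    {n u w : Fin 3 → K} (h : IsHyperbolicFrame q n u w) {B : linePartition K q}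
    (hB : B.1 = polarBlock q n) :
    ((quotientGraph Γ (linePartition K q)).neighborSet B).ncard * (q + 1) =
      {m | hermForm q m m = -1 ∧ hermForm q n m ^ (q + 1) ∈ normSet q O ∧
        (hermForm q u m ≠ 0 ∨ hermForm q w m ≠ 0)}.ncard := by
  rw [← Set.ncard_image_of_injective _ Subtype.val_injective, ← hF.ncard_image_polarBlock]
  · congr 2
    ext D
    constructor
    · rintro ⟨D, hD, rfl⟩
      obtain ⟨m, hm, hDm⟩ := (hF.mem_linePartition_iff D.1).1 D.2
      obtain ⟨hT, v, hv, hvv, hvn, hvm⟩ := (hΓ.quotient_adj_iff hF h.nn hm hB hDm).1 hD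
      refine ⟨m, ⟨hm, hT, ?_⟩, hDm.symm⟩
      -- Every isotropic vector of n^⊥ is a combination of u and w, so testing these two suffices.
      by_contra! hc
      apply hvm
      obtain ⟨a, b, rfl⟩ := h.exists_of_orthogonal hF hvn
      rw [hermForm_add_left, hermForm_smul_left, hermForm_smul_left, hc.1, hc.2]
      ring
    · rintro ⟨m, ⟨hm, hT, hor⟩, rfl⟩
      refine ⟨⟨polarBlock q m, (hF.mem_linePartition_iff _).2 ⟨m, hm, rfl⟩⟩,
        (hΓ.quotient_adj_iff hF h.nn hm hB rfl).2 ⟨hT, ?_⟩, rfl⟩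
      rcases hor with hc | hc
      · exact ⟨u, h.u_ne_zero, h.uu, h.un, hc⟩
      · exact ⟨w, (h.symm hF).u_ne_zero, h.ww, h.wn, hc⟩
  · rintro m ⟨hm, -⟩
    exact hm
  · rintro m ⟨hm, h2, h1⟩ z hz
    have hz0 : z ^ q ≠ 0 := by
      refine pow_ne_zero _ ?_
      rintro rfl
      simp at hz
    refine ⟨by rw [hermForm_smul_self hz, hm], ?_, ?_⟩
    · rwa [hermForm_smul_right, mul_pow, hF.pow_pow_succ, hz, one_mul]
    · rw [hermForm_smul_right, hermForm_smul_right]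
      exact h1.imp (mul_ne_zero hz0) (mul_ne_zero hz0)

theorem ncard_quotient_neighborSet_of_one_notMem (hF : IsQuadraticFrobenius K q)
    (hΓ : IsUnitaryGraph q O Γ) (h1 : (1 : K) ∉ normSet q O) (B : linePartition K q) :
    ((quotientGraph Γ (linePartition K q)).neighborSet B).ncard * (q + 1) =
      {a : K | a ^ (q + 1) ∈ normSet q O}.ncard * ((q ^ 2 - 1) * q) := by
  obtain ⟨n, hn, hB⟩ := (hF.mem_linePartition_iff B.1).1 B.2
  obtain ⟨u, w, h⟩ := hF.exists_frame_of_norm hn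
  rw [hΓ.ncard_quotient_neighborSet hF h hB, ← h.ncard_vectors_of_ne_zero hF]
  congr 1
  ext m
  refine and_congr_right fun hm => and_congr_right fun hT => ⟨fun _ hum => ?_, Or.inl⟩
  exact h1 (hF.norm_eq_one_of_orthogonal hn h.u_ne_zero h.uu h.un hm hum ▸ hT)

/-- The second summand accounts for the vectors m with β(u,m) = 0 and β(w,m) ≠ 0, that is, for the
other lines through ⟨u⟩. They are lost when counting the neighbours of the flag (⟨u⟩, n) only. -/
theorem ncard_quotient_neighborSet_of_eq_one (hF : IsQuadraticFrobenius K q)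
    (hΓ : IsUnitaryGraph q O Γ) (h1 : normSet q O = {1}) (B : linePartition K q) :
    ((quotientGraph Γ (linePartition K q)).neighborSet B).ncard * (q + 1) =
      (q + 1) * ((q ^ 2 - 1) * q) + (q + 1) * (q ^ 2 - 1) := by
  have := hF.finite
  obtain ⟨n, hn, hB⟩ := (hF.mem_linePartition_iff B.1).1 B.2
  obtain ⟨u, w, h⟩ := hF.exists_frame_of_norm hn
  rw [hΓ.ncard_quotient_neighborSet hF h hB, ← h.ncard_vectors_of_eq_zero hF]
  nth_rewrite 2 [← hF.ncard_norm_eq_one]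
  have h2 := h.ncard_vectors_of_ne_zero hF (normSet q O)
  simp only [h1, Set.mem_singleton_iff] at h2 ⊢
  rw [← h2, ← Set.ncard_union_eq]
  · congr 1
    ext m
    simp only [Set.mem_ofPred_eq, Set.mem_union]
    tauto
  · rw [Set.disjoint_left]
    rintro m ⟨-, -, hm⟩ ⟨-, -, hm', -⟩
    exact hm hm'

/-! ### Edges between two adjacent blocks -/

theorem setNeighbors_inter_eq {V : Type*} (G : SimpleGraph V) (B D : Set V) :
    setNeighbors G D ∩ B = {f | f ∈ B ∧ (D ∩ G.neighborSet f).Nonempty} := by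
  ext f
  simp only [setNeighbors, Set.mem_inter_iff, Set.mem_iUnion, Set.mem_ofPred_eq]
  constructor
  · rintro ⟨⟨g, hg, h⟩, hf⟩
    exact ⟨hf, g, hg, SimpleGraph.Adj.symm h⟩
  · rintro ⟨hf, g, hg, h⟩
    exact ⟨⟨g, hg, SimpleGraph.Adj.symm h⟩, hf⟩

/-- Whether the flag's point lies on the other line is the only obstruction depending on the flag,
and it would put 1 into `normSet`. -/
theorem inter_neighborSet_nonempty (hF : IsQuadraticFrobenius K q) (hΓ : IsUnitaryGraph q O Γ)
    (h1 : (1 : K) ∉ normSet q O) {B D : linePartition K q}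
    (hBD : (quotientGraph Γ (linePartition K q)).Adj B D) {f : unitalFlags K q}
    (hf : f ∈ B.1) : (D.1 ∩ Γ.neighborSet f).Nonempty := by
  obtain ⟨n, hn, hB⟩ := (hF.mem_linePartition_iff B.1).1 B.2
  obtain ⟨m, hm, hD⟩ := (hF.mem_linePartition_iff D.1).1 D.2
  obtain ⟨hT, -⟩ := (hΓ.quotient_adj_iff hF hn hm hB hD).1 hBD
  rw [hB] at hf
  obtain ⟨u, hu⟩ := exists_isFlagRep_of_line f hn hf
  rw [hD]
  refine (hΓ.neighbours_nonempty_iff hF hu hm).2 ⟨fun hum => ?_, hT⟩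
  exact h1 (hF.norm_eq_one_of_orthogonal hn hu.u_ne_zero hu.uu hu.un hm hum ▸ hT)

theorem isMulticover (hF : IsQuadraticFrobenius K q) (hΓ : IsUnitaryGraph q O Γ)
    (h1 : (1 : K) ∉ normSet q O) : IsMulticover Γ (linePartition K q) := by
  intro B D hBD
  rw [setNeighbors_inter_eq]
  congr 1
  ext f
  exact ⟨fun hf => hf.1, fun hf => ⟨hf, hΓ.inter_neighborSet_nonempty hF h1 hBD hf⟩⟩

/-- If all norms are one, each block contains exactly one flag without neighbours in a given
adjacent block. -/
theorem ncard_isolated (hF : IsQuadraticFrobenius K q) (hΓ : IsUnitaryGraph q O Γ)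
    (h1 : normSet q O = {1}) {B D : linePartition K q}
    (hBD : (quotientGraph Γ (linePartition K q)).Adj B D) :
    {f | f ∈ B.1 ∧ D.1 ∩ Γ.neighborSet f = ∅}.ncard = 1 := by
  obtain ⟨n, hn, hB⟩ := (hF.mem_linePartition_iff B.1).1 B.2
  obtain ⟨m, hm, hD⟩ := (hF.mem_linePartition_iff D.1).1 D.2
  obtain ⟨hT, u, hu, huu, hun, hum⟩ := (hΓ.quotient_adj_iff hF hn hm hB hD).1 hBD
  have hT' := hT
  rw [h1, Set.mem_singleton_iff, pow_succ, ← hF.hermForm_comm] at hT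
  -- The projection of m to n^⊥. As N(β(n,m)) = 1, the Gram determinant of n and m vanishes, so v is
  -- isotropic and orthogonal to both: it spans the common point of the two lines.
  set v := m + hermForm q m n • n with hv
  have hvn : hermForm q v n = 0 := by
    rw [hv, hermForm_add_left, hermForm_smul_left, hn]
    ring
  have hvm : hermForm q v m = 0 := by
    rw [hv, hermForm_add_left, hermForm_smul_left, hm]
    linear_combination hT
  have hvv : hermForm q v v = 0 := by
    nth_rewrite 2 [hv]
    rw [hF.hermForm_add_right, hermForm_smul_right, hvm, hvn]
    ring
  have hv0 : v ≠ 0 := by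
    intro h0
    have h3 : hermForm q u v = 0 := by
      rw [h0, ← zero_smul K u, hermForm_smul_right, hF.zero_pow, zero_mul]
    rw [hv, hF.hermForm_add_right, hermForm_smul_right, hun, mul_zero, add_zero] at h3
    exact hum h3
  obtain ⟨f₀, hf₀⟩ := hF.exists_flag hn hv0 hvv hvn
  rw [Set.ncard_eq_one]
  refine ⟨f₀, ?_⟩
  ext f
  rw [Set.mem_singleton_iff, hB, hD]
  constructor
  · rintro ⟨hf, hemp⟩
    obtain ⟨x, hx⟩ := exists_isFlagRep_of_line f hn hf
    have hxm : hermForm q x m = 0 := by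
      by_contra hxm
      exact ((hΓ.neighbours_nonempty_iff hF hx hm).2 ⟨hxm, hT'⟩).ne_empty hemp
    have hxv : hermForm q x v = 0 := by
      rw [hv, hF.hermForm_add_right, hermForm_smul_right, hxm, hx.un]
      ring
    obtain ⟨a, ha⟩ := hF.mem_span_of_isotropic hv0 hvv hx.uu hxv
    refine (hf₀.eq hx (a := a) ?_ ha).symm
    rintro rfl
    exact hx.u_ne_zero (by rw [ha, zero_smul])
  · rintro rfl
    refine ⟨hf₀.mem_polarBlock, ?_⟩
    rw [← Set.not_nonempty_iff_eq_empty]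
    exact fun hne => ((hΓ.neighbours_nonempty_iff hF hf₀ hm).1 hne).1 hvm

theorem isAlmostMulticover (hF : IsQuadraticFrobenius K q) (hΓ : IsUnitaryGraph q O Γ)
    (h1 : normSet q O = {1}) : IsAlmostMulticover Γ (linePartition K q) := by
  have := hF.finite
  intro B D hBD
  rw [setNeighbors_inter_eq, ← hΓ.ncard_isolated hF h1 hBD, ← Set.ncard_union_eq]
  · congr 1
    ext f
    simp only [Set.mem_union, Set.mem_ofPred_eq, ← and_or_left, ← Set.not_nonempty_iff_eq_empty]
    exact ⟨fun h => h.1, fun h => ⟨h, Classical.em _⟩⟩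
  · rw [Set.disjoint_left]
    rintro f ⟨-, hf⟩ ⟨-, hf'⟩
    exact hf.ne_empty hf'

/-- The number of neighbours of a flag in an adjacent block, if there are any. -/
theorem ncard_inter_neighborSet (hF : IsQuadraticFrobenius K q) (hΓ : IsUnitaryGraph q O Γ)
    {d : ℕ} (hd : ∀ h : K, h ^ (q + 1) ∈ normSet q O → (connectors q O h).ncard = d)
    {D : linePartition K q} {f : unitalFlags K q} (hne : (D.1 ∩ Γ.neighborSet f).Nonempty) :
    (D.1 ∩ Γ.neighborSet f).ncard = d := by
  obtain ⟨u, n, hf⟩ := hF.exists_isFlagRep f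
  obtain ⟨m, hm, hD⟩ := (hF.mem_linePartition_iff D.1).1 D.2
  rw [hD] at hne ⊢
  obtain ⟨hum, hT⟩ := (hΓ.neighbours_nonempty_iff hF hf hm).1 hne
  rw [polarBlock, hΓ.ncard_neighbours hF hf hm hum, hd _ hT]

/-- The neighbours of a flag in the graph induced on two blocks. -/
theorem image_induce_neighborSet (hF : IsQuadraticFrobenius K q) (hΓ : IsUnitaryGraph q O Γ)
    {B D : linePartition K q} {S : Set (unitalFlags K q)} (hS : S = B.1 ∪ D.1) {x : S}
    (hx : x.1 ∈ B.1) :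
    Subtype.val '' (Γ.induce S).neighborSet x = D.1 ∩ Γ.neighborSet x.1 := by
  obtain ⟨n, hn, hB⟩ := (hF.mem_linePartition_iff B.1).1 B.2
  ext g
  constructor
  · rintro ⟨g, hg, rfl⟩
    have hg' : Γ.Adj x.1 g.1 := hg
    refine ⟨?_, hg'⟩
    have hgS : g.1 ∈ B.1 ∪ D.1 := hS ▸ g.2
    rcases hgS with h | h
    · exact absurd hg' (hΓ.not_adj_of_mem_polarBlock hF hn (hB ▸ hx) (hB ▸ h))
    · exact h
  · rintro ⟨hgD, hg⟩
    exact ⟨⟨g, hS ▸ Or.inr hgD⟩, hg, rfl⟩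

end IsUnitaryGraph

end Blocks

/-! ### The unitary graphs -/

namespace IsUnitaryGraph

variable {K : Type*} [Field K] {q : ℕ} {O : Set K} {Γ : SimpleGraph (unitalFlags K q)}

theorem ncard_induce_neighborSet (hF : IsQuadraticFrobenius K q) (hΓ : IsUnitaryGraph q O Γ)
    {d : ℕ} (hd : ∀ h : K, h ^ (q + 1) ∈ normSet q O → (connectors q O h).ncard = d)
    {B D : linePartition K q} {S : Set (unitalFlags K q)} (hS : S = B.1 ∪ D.1) (x : S)
    (hne : (Γ.induce S).neighborSet x ≠ ∅) : ((Γ.induce S).neighborSet x).ncard = d := by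
  -- With S a variable, the same argument applies with the roles of B and D exchanged.
  have aux : ∀ {B D : linePartition K q}, S = B.1 ∪ D.1 → x.1 ∈ B.1 →
      ((Γ.induce S).neighborSet x).ncard = d := by
    intro B D hS hx
    have h := hΓ.image_induce_neighborSet hF hS hx
    rw [← Set.ncard_image_of_injective _ Subtype.val_injective, h]
    refine hΓ.ncard_inter_neighborSet hF hd ?_
    rw [← h]
    exact (Set.nonempty_iff_ne_empty.2 hne).image _
  have hx : x.1 ∈ B.1 ∪ D.1 := hS ▸ x.2
  rcases hx with hx | hx
  · exact aux hS hx
  · exact aux (hS.trans (Set.union_comm _ _)) hx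

theorem hasValency_induce (hF : IsQuadraticFrobenius K q) (hΓ : IsUnitaryGraph q O Γ)
    {d : ℕ} (hd : ∀ h : K, h ^ (q + 1) ∈ normSet q O → (connectors q O h).ncard = d)
    (h1 : (1 : K) ∉ normSet q O) {B D : linePartition K q}
    (hBD : (quotientGraph Γ (linePartition K q)).Adj B D) :
    HasValency (Γ.induce (B.1 ∪ D.1)) d := by
  intro x
  refine hΓ.ncard_induce_neighborSet hF hd rfl x ?_
  rw [← Set.nonempty_iff_ne_empty, ← Set.image_nonempty (f := Subtype.val)]
  rcases x.2 with hx | hx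
  · rw [hΓ.image_induce_neighborSet hF rfl hx]
    exact hΓ.inter_neighborSet_nonempty hF h1 hBD hx
  · rw [hΓ.image_induce_neighborSet hF (Set.union_comm _ _) hx]
    exact hΓ.inter_neighborSet_nonempty hF h1 hBD.symm hx

theorem ncard_induce_isolated (hF : IsQuadraticFrobenius K q) (hΓ : IsUnitaryGraph q O Γ)
    (h1 : normSet q O = {1}) {B D : linePartition K q}
    (hBD : (quotientGraph Γ (linePartition K q)).Adj B D) :
    {x | (Γ.induce (B.1 ∪ D.1)).neighborSet x = ∅}.ncard = 2 := by
  have := hF.finite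
  have key : ∀ x : ↥(B.1 ∪ D.1), (Γ.induce (B.1 ∪ D.1)).neighborSet x = ∅ ↔
      Subtype.val '' (Γ.induce (B.1 ∪ D.1)).neighborSet x = ∅ := fun x => Set.image_eq_empty.symm
  have himg : Subtype.val '' {x | (Γ.induce (B.1 ∪ D.1)).neighborSet x = ∅} =
      {f | f ∈ B.1 ∧ D.1 ∩ Γ.neighborSet f = ∅} ∪ {f | f ∈ D.1 ∧ B.1 ∩ Γ.neighborSet f = ∅} := by
    ext f
    constructor
    · rintro ⟨x, hx, rfl⟩
      have hx' := (key x).1 hx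
      rcases x.2 with hxB | hxD
      · rw [hΓ.image_induce_neighborSet hF rfl hxB] at hx'
        exact Or.inl ⟨hxB, hx'⟩
      · rw [hΓ.image_induce_neighborSet hF (Set.union_comm _ _) hxD] at hx'
        exact Or.inr ⟨hxD, hx'⟩
    · rintro (⟨hf, hf'⟩ | ⟨hf, hf'⟩)
      · refine ⟨⟨f, Or.inl hf⟩, (key _).2 ?_, rfl⟩
        rwa [hΓ.image_induce_neighborSet hF rfl hf]
      · refine ⟨⟨f, Or.inr hf⟩, (key _).2 ?_, rfl⟩
        rwa [hΓ.image_induce_neighborSet hF (Set.union_comm _ _) hf]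
  rw [← Set.ncard_image_of_injective _ Subtype.val_injective, himg, Set.ncard_union_eq,
    hΓ.ncard_isolated hF h1 hBD, hΓ.ncard_isolated hF h1 hBD.symm]
  rw [Set.disjoint_left]
  rintro f ⟨hf, -⟩ ⟨hf', -⟩
  exact hBD.1 (Subtype.ext ((hF.isPartition_linePartition.2 f).unique ⟨B.2, hf⟩ ⟨D.2, hf'⟩))

/-- The block of a flag. -/
def blockOf (f : unitalFlags K q) : linePartition K q :=
  ⟨flagsOnLine q f.1.2, f.1.2, f.2.2.1, rfl⟩

theorem mem_blockOf (f : unitalFlags K q) : f ∈ (blockOf f).1 := rfl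

theorem blockOf_eq_iff (hF : IsQuadraticFrobenius K q) (f : unitalFlags K q)
    (B : linePartition K q) : blockOf f = B ↔ f ∈ B.1 := by
  constructor
  · rintro rfl
    exact mem_blockOf f
  · intro h
    exact Subtype.ext ((hF.isPartition_linePartition.2 f).unique
      ⟨(blockOf f).2, mem_blockOf f⟩ ⟨B.2, h⟩)

/-- A flag has neighbours in each adjacent block, and then q+1 of them, which is the whole block.
Adjacency hence depends only on the blocks, and any labelling of each block by q+1 elements gives an
isomorphism. -/
theorem nonempty_iso_lexProduct (hF : IsQuadraticFrobenius K q) (hΓ : IsUnitaryGraph q O Γ)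
    (hd : ∀ h : K, h ^ (q + 1) ∈ normSet q O → (connectors q O h).ncard = q + 1)
    (h1 : (1 : K) ∉ normSet q O) :
    Nonempty (Γ ≃g lexProduct (quotientGraph Γ (linePartition K q))
      (⊥ : SimpleGraph (Fin (q + 1)))) := by
  have := hF.finite
  have hcard : ∀ B : linePartition K q, B.1.ncard = q + 1 := by
    intro B
    obtain ⟨n, hn, hB⟩ := (hF.mem_linePartition_iff B.1).1 B.2
    rw [hB, hF.ncard_polarBlock hn]
  have hadj : ∀ f g : unitalFlags K q, Γ.Adj f g ↔
      (quotientGraph Γ (linePartition K q)).Adj (blockOf f) (blockOf g) := by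
    intro f g
    constructor
    · intro h
      refine ⟨fun hfg => ?_, f, mem_blockOf f, g, mem_blockOf g, h⟩
      obtain ⟨u, n, hf⟩ := hF.exists_isFlagRep f
      refine hΓ.not_adj_of_mem_polarBlock hF hf.nn hf.mem_polarBlock ?_ h
      have hg : g ∈ (blockOf f).1 := hfg ▸ mem_blockOf g
      exact Eq.trans hg hf.line
    · intro h
      have hne := hΓ.inter_neighborSet_nonempty hF h1 h (mem_blockOf f)
      have heq : (blockOf g).1 ∩ Γ.neighborSet f = (blockOf g).1 :=
        Set.eq_of_subset_of_ncard_le Set.inter_subset_left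
          (by rw [hΓ.ncard_inter_neighborSet hF hd hne, hcard])
      have hg := mem_blockOf g
      rw [← heq] at hg
      exact hg.2
  have hfib : ∀ B : linePartition K q,
      Nonempty ({f : unitalFlags K q // blockOf f = B} ≃ Fin (q + 1)) := by
    intro B
    refine ⟨Finite.equivFinOfCardEq ?_⟩
    rw [← hcard B]
    change Nat.card {f : unitalFlags K q // blockOf f = B} = Nat.card B.1
    exact Nat.card_congr (Equiv.subtypeEquivRight fun f => blockOf_eq_iff hF f B)
  let φ := fun B => (hfib B).some
  let Φ : unitalFlags K q ≃ linePartition K q × Fin (q + 1) :=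
    (Equiv.sigmaFiberEquiv blockOf).symm.trans
      ((Equiv.sigmaCongrRight φ).trans (Equiv.sigmaEquivProd _ _))
  have hΦ : ∀ f, (Φ f).1 = blockOf f := fun f => rfl
  refine ⟨⟨Φ, ?_⟩⟩
  intro f g
  change (quotientGraph Γ (linePartition K q)).Adj (Φ f).1 (Φ g).1 ∨ _ ∧ False ↔ _
  rw [hΦ, hΦ, and_false, or_false, hadj]

end IsUnitaryGraph

/-- Clearing denominators gives (1 - λ)(1 - λ^q) = λλ^q, where the quadratic terms cancel. -/
theorem IsQuadraticFrobenius.norm_eq_one_iff {K : Type*} [Field K] {q : ℕ} (hF : IsQuadraticFrobenius K q) {lam : K}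
    (h0 : lam ≠ 0) : (lam⁻¹ - 1) ^ (q + 1) = 1 ↔ lam + lam ^ q = 1 := by
  have hq : lam ^ q ≠ 0 := pow_ne_zero _ h0
  rw [pow_succ, hF.sub_pow, one_pow, inv_pow]
  field_simp
  constructor
  · intro h
    linear_combination -h
  · intro h
    linear_combination -h

/-! ### The orbit of λ and its set of norms -/

section Parameters

variable {p e r : ℕ} {K : Type*} [Fact p.Prime] [Field K] [Finite K] [CharP K p]

theorem finite_frobGroup : Finite (frobGroup p r K) := by
  have : Finite (RingAut K) := Finite.of_injective (fun f : RingAut K => (f : K → K))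
    DFunLike.coe_injective
  infer_instance

theorem isUnitaryGraph_unitaryGraph (hq : 2 < p ^ e) (hK : Nat.card K = (p ^ e) ^ 2)
    (hr : r ∣ 2 * e) {lam : K} (h0 : lam ≠ 0)
    (hlam : lam ^ p ^ e ∈ MulAction.orbit (frobGroup p r K) lam) :
    IsUnitaryGraph (p ^ e) (MulAction.orbit (frobGroup p r K) lam)
      (unitaryGraph p e r hq hK hr lam h0 hlam) where
  zero_notMem h := ne_zero_of_mem_frobGroup_orbit h0 h rfl
  adj_iff hf hg := unitaryAdj_iff p e r hq hK hr h0 hlam hf hg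

theorem ncard_frobGroup_orbit (x : K) :
    (MulAction.orbit (frobGroup p r K) x).ncard = kNumber p r x := by
  have := finite_frobGroup (p := p) (r := r) (K := K)
  exact ncard_orbit_eq_card_div x

theorem frobGroup_smul_norm (q : ℕ) (g : frobGroup p r K) (x : K) :
    ((g • x)⁻¹ - 1) ^ (q + 1) = g • (x⁻¹ - 1) ^ (q + 1) := by
  change (((g : RingAut K) x)⁻¹ - 1) ^ (q + 1) = (g : RingAut K) ((x⁻¹ - 1) ^ (q + 1))
  rw [map_pow, map_sub, map_inv₀, map_one]

/-- The map μ ↦ N(μ⁻¹ - 1) commutes with field automorphisms, so it carries orbits to orbits. -/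
theorem normSet_frobGroup_orbit (q : ℕ) (lam : K) :
    normSet q (MulAction.orbit (frobGroup p r K) lam) =
      MulAction.orbit (frobGroup p r K) ((lam⁻¹ - 1) ^ (q + 1)) := by
  ext t
  constructor
  · rintro ⟨_, ⟨g, rfl⟩, rfl⟩
    exact ⟨g, (frobGroup_smul_norm q g lam).symm⟩
  · rintro ⟨g, rfl⟩
    exact ⟨g • lam, ⟨g, rfl⟩, frobGroup_smul_norm q g lam⟩

theorem frobGroup_orbit_one : MulAction.orbit (frobGroup p r K) (1 : K) = {1} := by
  ext x
  constructor
  · rintro ⟨g, rfl⟩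
    exact map_one (g : RingAut K)
  · rintro rfl
    exact MulAction.mem_orbit_self _

theorem lNumber_eq {lam : K} (h0 : lam ≠ 0) :
    lNumber p e r lam = (normSet (p ^ e) (MulAction.orbit (frobGroup p r K) lam)).ncard := by
  rw [normSet_frobGroup_orbit, ncard_frobGroup_orbit, lNumber, sub_div, div_self h0, one_div]

/-- Since 1 is fixed by the group, it lies in the orbit of N(λ⁻¹ - 1) only if it equals that
element. -/
theorem one_notMem_normSet {q : ℕ} (hF : IsQuadraticFrobenius K q) {lam : K} (h0 : lam ≠ 0)
    (h : lam + lam ^ q ≠ 1) : (1 : K) ∉ normSet q (MulAction.orbit (frobGroup p r K) lam) := by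
  rw [normSet_frobGroup_orbit, MulAction.mem_orbit_symm, frobGroup_orbit_one,
    Set.mem_singleton_iff, hF.norm_eq_one_iff h0]
  exact h

theorem normSet_eq_one {q : ℕ} (hF : IsQuadraticFrobenius K q) {lam : K} (h0 : lam ≠ 0)
    (h : lam + lam ^ q = 1) : normSet q (MulAction.orbit (frobGroup p r K) lam) = {1} := by
  rw [normSet_frobGroup_orbit, (hF.norm_eq_one_iff h0).2 h, frobGroup_orbit_one]

theorem normSet_of_eq_one (q : ℕ) :
    normSet q (MulAction.orbit (frobGroup p r K) (1 : K)) = {0} := by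
  rw [frobGroup_orbit_one]
  simp [normSet]

theorem exists_of_mem_normSet {q : ℕ} {lam : K} (h1 : lam ≠ 1) {t : K}
    (ht : t ∈ normSet q (MulAction.orbit (frobGroup p r K) lam)) :
    ∃ a : K, a ≠ 0 ∧ t = a ^ (q + 1) := by
  obtain ⟨_, ⟨g, rfl⟩, rfl⟩ := ht
  refine ⟨_, fun h => h1 ?_, rfl⟩
  have h2 : g • lam = 1 := inv_eq_one.1 (sub_eq_zero.1 h)
  exact (map_eq_one_iff (g : RingAut K) (RingEquiv.injective _)).1 h2

/-- For h ≠ 0 the connectors correspond to a fibre of the equivariant surjection from the orbit of λ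
to its set of norms. This yields both the divisibility of k* by l* and the valency k*/l*. -/
theorem ncard_normSet_mul_ncard_connectors {q : ℕ} (hF : IsQuadraticFrobenius K q) {lam : K}
    (h1 : lam ≠ 1) {h : K}
    (ht : h ^ (q + 1) ∈ normSet q (MulAction.orbit (frobGroup p r K) lam)) :
    (normSet q (MulAction.orbit (frobGroup p r K) lam)).ncard *
      (connectors q (MulAction.orbit (frobGroup p r K) lam) h).ncard = kNumber p r lam := by
  have hne : h ≠ 0 := by
    rintro rfl
    obtain ⟨a, ha, he⟩ := exists_of_mem_normSet h1 ht
    rw [_root_.zero_pow (Nat.succ_ne_zero q)] at he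
    exact pow_ne_zero _ ha he.symm
  rw [hF.ncard_connectors _ hne, ← ncard_frobGroup_orbit]
  rw [normSet_frobGroup_orbit] at ht ⊢
  exact (ncard_orbit_eq_mul_fiber (fun x : K => (x⁻¹ - 1) ^ (q + 1)) (frobGroup_smul_norm q) lam ht).symm

end Parameters

theorem theorem3 (p e r : ℕ) (K : Type*) [Fact p.Prime] [Field K] [Finite K] [CharP K p]
    (hq : 2 < p ^ e) (hK : Nat.card K = (p ^ e) ^ 2) (hr : r ∣ 2 * e) (lam : K) (h0 : lam ≠ 0)
    (hlam : lam ^ p ^ e ∈ MulAction.orbit (frobGroup p r K) lam)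
    (Γ : SimpleGraph (unitalFlags K (p ^ e)))
    (hΓ : Γ = unitaryGraph p e r hq hK hr lam h0 hlam)
    (C : Set (Set (unitalFlags K (p ^ e)))) (hC : C = linePartition K (p ^ e))
    (k l : ℕ) (hk : k = kNumber p r lam) (hl : l = lNumber p e r lam) :
    -- `C` is a partition of the vertex set into independent sets of size `q + 1`, `q = p ^ e`
    (Setoid.IsPartition C ∧
      ∀ B ∈ C, B.ncard = p ^ e + 1 ∧ ∀ v ∈ B, ∀ w ∈ B, ¬ Γ.Adj v w) ∧
    -- the valency of the quotient graph
    ((lam = 1 → HasValency (quotientGraph Γ C) (p ^ e * (p ^ e - 1))) ∧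
      (lam ≠ 1 → lam + lam ^ p ^ e ≠ 1 →
        HasValency (quotientGraph Γ C) (p ^ e * ((p ^ e) ^ 2 - 1) * l)) ∧
      (lam + lam ^ p ^ e = 1 →
        HasValency (quotientGraph Γ C) ((p ^ e + 1) * ((p ^ e) ^ 2 - 1)))) ∧
    -- the number of blocks containing at least one neighbour of a fixed vertex
    (∀ v : unitalFlags K (p ^ e),
      (lam = 1 → {B ∈ C | (B ∩ Γ.neighborSet v).Nonempty}.ncard = p ^ e * (p ^ e - 1)) ∧
      (lam ≠ 1 → lam + lam ^ p ^ e ≠ 1 →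
        {B ∈ C | (B ∩ Γ.neighborSet v).Nonempty}.ncard = p ^ e * ((p ^ e) ^ 2 - 1) * l) ∧
      (lam + lam ^ p ^ e = 1 →
        {B ∈ C | (B ∩ Γ.neighborSet v).Nonempty}.ncard = p ^ e * ((p ^ e) ^ 2 - 1))) ∧
    -- the structure of the graph relative to its quotient
    ((lam = 1 →
        Nonempty (Γ ≃g lexProduct (quotientGraph Γ C) (⊥ : SimpleGraph (Fin (p ^ e + 1))))) ∧
      (lam ≠ 1 → lam + lam ^ p ^ e ≠ 1 →
        IsMulticover Γ C ∧ l ∣ k ∧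
        ∀ B D : C, (quotientGraph Γ C).Adj B D →
          HasValency (Γ.induce (B.1 ∪ D.1)) (k / l)) ∧
      (lam + lam ^ p ^ e = 1 →
        IsAlmostMulticover Γ C ∧
        ∀ B D : C, (quotientGraph Γ C).Adj B D →
          {x | (Γ.induce (B.1 ∪ D.1)).neighborSet x = ∅}.ncard = 2 ∧
          ∀ x, (Γ.induce (B.1 ∪ D.1)).neighborSet x ≠ ∅ →
            ((Γ.induce (B.1 ∪ D.1)).neighborSet x).ncard = k)) := by
  have hF := isQuadraticFrobenius_of_card (p := p) (e := e) hq hK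
  have hU := isUnitaryGraph_unitaryGraph hq hK hr h0 hlam
  rw [← hΓ] at hU
  have hl' := lNumber_eq (p := p) (e := e) (r := r) h0
  rw [← hl] at hl'
  subst hC
  clear hΓ hl
  have hnorm_one := normSet_of_eq_one (p := p) (r := r) (K := K) (p ^ e)
  generalize p ^ e = q at *
  have hsq : q ^ 2 - 1 = (q - 1) * (q + 1) := by
    obtain ⟨n, rfl⟩ : ∃ n, q = n + 1 := ⟨q - 1, by omega⟩
    rw [Nat.add_sub_cancel, show (n + 1) ^ 2 = n * (n + 1 + 1) + 1 by ring, Nat.add_sub_cancel]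
  have hne : q + 1 ≠ 0 := Nat.succ_ne_zero q
  have hne_one : lam + lam ^ q = 1 → lam ≠ 1 := by
    rintro h rfl
    rw [one_pow, add_eq_left] at h
    exact one_ne_zero h
  have hadd_one : lam = 1 → lam + lam ^ q ≠ 1 := fun h h' => hne_one h' h
  set O := MulAction.orbit (frobGroup p r K) lam with hO
  have hA_one : lam = 1 → {a : K | a ^ (q + 1) ∈ normSet q O}.ncard = 1 := by
    rintro rfl
    rw [hO, hnorm_one, Set.ncard_eq_one]
    exact ⟨0, by ext a; simp⟩
  have hA : lam ≠ 1 → {a : K | a ^ (q + 1) ∈ normSet q O}.ncard = l * (q + 1) := by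
    intro h1
    rw [hl']
    exact hF.ncard_norm_mem fun t ht => exists_of_mem_normSet h1 ht
  have hT : lam + lam ^ q ≠ 1 → (1 : K) ∉ normSet q O := one_notMem_normSet hF h0
  have hT1 : lam + lam ^ q = 1 → normSet q O = {1} := normSet_eq_one hF h0
  have hl1 : lam + lam ^ q = 1 → l = 1 := fun h => by
    rw [hl', hT1 h, Set.ncard_singleton]
  refine ⟨⟨hF.isPartition_linePartition, ?_⟩, ⟨?_, ?_, ?_⟩, fun v => ⟨?_, ?_, ?_⟩, ?_, ?_, ?_⟩
  · intro B hB
    obtain ⟨n, hn, rfl⟩ := (hF.mem_linePartition_iff B).1 hB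
    exact ⟨hF.ncard_polarBlock hn, fun v hv w hw => hU.not_adj_of_mem_polarBlock hF hn hv hw⟩
  · intro h B
    -- The counts are of vectors, and each block comes from q+1 of them; the same factor is
    -- cancelled in every valency below.
    apply Nat.eq_of_mul_eq_mul_right (Nat.pos_of_ne_zero hne)
    rw [hU.ncard_quotient_neighborSet_of_one_notMem hF (hT (hadd_one h)), hA_one h, hsq]
    ring
  · intro h1 h B
    apply Nat.eq_of_mul_eq_mul_right (Nat.pos_of_ne_zero hne)
    rw [hU.ncard_quotient_neighborSet_of_one_notMem hF (hT h), hA h1]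
    ring
  · intro h B
    apply Nat.eq_of_mul_eq_mul_right (Nat.pos_of_ne_zero hne)
    rw [hU.ncard_quotient_neighborSet_of_eq_one hF (hT1 h)]
    ring
  · intro h
    apply Nat.eq_of_mul_eq_mul_right (Nat.pos_of_ne_zero hne)
    rw [hU.ncard_blocks_of_vertex hF, hA_one h, hsq]
    ring
  · intro h1 h
    apply Nat.eq_of_mul_eq_mul_right (Nat.pos_of_ne_zero hne)
    rw [hU.ncard_blocks_of_vertex hF, hA h1]
    ring
  · intro h
    apply Nat.eq_of_mul_eq_mul_right (Nat.pos_of_ne_zero hne)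
    rw [hU.ncard_blocks_of_vertex hF, hA (hne_one h), hl1 h]
    ring
  · intro h
    refine hU.nonempty_iso_lexProduct hF ?_ (hT (hadd_one h))
    intro x hx
    have hO1 : O = {1} := by rw [hO, h, frobGroup_orbit_one]
    rw [hO, h, hnorm_one, Set.mem_singleton_iff] at hx
    -- For λ = 1 only the value 0 occurs, and it is connected by all q+1 elements of norm one.
    rw [eq_zero_of_pow_eq_zero hx, hO1, connectors_zero, hF.ncard_norm_eq_one]
  · intro h1 h
    have hlk : l ∣ k := by
      -- The divisibility does not involve any edge, so the product formula is applied to h = λ⁻¹ -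
      -- 1.
      have hmem : (lam⁻¹ - 1) ^ (q + 1) ∈ normSet q O := ⟨lam, MulAction.mem_orbit_self lam, rfl⟩
      have := ncard_normSet_mul_ncard_connectors hF h1 hmem
      rw [hk, hl', ← this]
      exact Dvd.intro _ rfl
    refine ⟨hU.isMulticover hF (hT h), hlk, fun B D hBD => ?_⟩
    refine hU.hasValency_induce hF (fun x hx => ?_) (hT h) hBD
    have hm := ncard_normSet_mul_ncard_connectors hF h1 hx
    rw [hk, ← hm, hl', Nat.mul_div_cancel_left]
    exact (Set.ncard_pos).2 ⟨_, hx⟩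
  · intro h
    refine ⟨hU.isAlmostMulticover hF (hT1 h), fun B D hBD =>
      ⟨hU.ncard_induce_isolated hF (hT1 h) hBD, fun x hx => ?_⟩⟩
    refine hU.ncard_induce_neighborSet hF (fun y hy => ?_) rfl x hx
    rw [hk, ← ncard_normSet_mul_ncard_connectors hF (hne_one h) hy, hT1 h, Set.ncard_singleton,
      one_mul]
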